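/- Let $t\in\mathbb Q^\times$, put $a=-\frac1{4t^2}$, $A=\frac{t^2+4}{64}$, and let $E,E'$ be the elliptic curves over $\mathbb Q$ $$E:\ y^2+xy+ay=x^3+ax^2,\qquad E':\ Y^2+XY+AY=X^3+AX^2 .$$ Let $G_{\mathbb Q}=\mathrm{Gal}(\overline{\mathbb Q}/\mathbb Q)$, and let $\mu_4\subset\overline{\mathbb Q}^\times$ be the group of fourth roots of unity. Cohomology is continuous cohomology with discrete coefficients. Let $\phi:E\to E'$, $(x,y)\mapsto(X,Y)$, and $\hat\phi:E'\to E$, $(X,Y)\mapsto(x,y)$, be given by $$X=-A+\Bigl(\tfrac{t(x+2a)(2y+x+a)}{8x(x+a)}\Bigr)^2,\qquad Y=X^2-(x+a)^2\Bigl(\tfrac{(2y+x+a)-2tx(x+2a)}{8x(x+a)}\Bigr)^4,$$ $$x=-a+\Bigl(\tfrac{X(2Y+X+A)}{2t(X+A)(X+2A)}\Bigr)^2,\qquad y=x^2-\Bigl(\tfrac{2(X+2A)(2Y+X+A)-tX(X+A)}{4t(X+A)(X+2A)}\Bigr)^4,$$ where $\mathcal O$ and the points at which the denominators vanish are sent to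 $\mathcal O$. On $\overline{\mathbb Q}$-points these are $G_{\mathbb Q}$-equivariant group homomorphisms with $\hat\phi\circ\phi=[4]$ and $\phi\circ\hat\phi=[4]$, $\hat\phi$ is surjective, and $E[\phi]=\ker\phi$ is generated by $T_0=(0,0)$. Write $E'[\hat\phi]=\ker\hat\phi$. Moreover: 1. There is a pairing $e_\phi:E'[\hat\phi]\times E[\phi]\to\mu_4$ that is bilinear, non-degenerate on both sides, Galois invariant ($e_\phi(\sigma T',\sigma T)=\sigma(e_\phi(T',T))$ for all $\sigma\in G_{\mathbb Q}$), and alternating in the sense that there is a bilinear, alternating, non-degenerate, Galois invariant pairing $e_4:E[4]\times E[4]\to\mu_4$ with $e_\phi(\phi(S),T)=e_4(S,T)$ for all $S\in E[4]$, $T\in E[\phi]$; and for each $i\in\overline{\mathbb Q}$ with $i^2=-1$, $$e_\phi(T',T_0)=i\quad\text{when}\quad T'=\Bigl(-2A,\ A\,\tfrac{2+i\,t}4\Bigr)\in E'[\hat\phi].$$ 2. There is a well-defined bilinear pairing $b:E(\mathbb Q)/\hat\phi(E'(\mathbb Q))\times E[\phi]\to\mathbb Q^\times/(\mathbb Q^\times)^4$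 given, for $m\in\mathbb Z$, by $$b(P,[m]T_0)=\begin{cases}1&P=\mathcal O,\\ a^{-m}&P=(0,0),\\ (x^2-y)^m&P=(x,y)\ne(0,0),\end{cases}$$ and it is non-degenerate on the left: if $b(P,T)=1$ for all $T\in E[\phi]$, then $P\in\hat\phi(E'(\mathbb Q))$. 3. For every $T\in E[\phi]$ the map $e_\phi(\cdot,T):E'[\hat\phi]\to\mu_4$ is a homomorphism of $G_{\mathbb Q}$-modules, and for $T=T_0$ it is an isomorphism. The Kummer map $\kappa:\mathbb Q^\times/(\mathbb Q^\times)^4\to H^1(G_{\mathbb Q},\mu_4)$, which sends the class of $d=\beta^4$ $(\beta\in\overline{\mathbb Q}^\times)$ to the class of $\sigma\mapsto\sigma(\beta)/\beta$, is an isomorphism. Hence, upon identifying $E'[\hat\phi]\simeq\mu_4$ by $e_\phi(\cdot,T_0)$, there is an isomorphism $\delta_{\mathbb Q}:\mathbb Q^\times/(\mathbb Q^\times)^4\to H^1(G_{\mathbb Q},E'[\hat\phi])$ with $e_\phi(\cdot,T_0)_*\circ\delta_{\mathbb Q}=\kappa$. 4. Let $\delta_E:E(\mathbb Q)/\hat\phi(E'(\mathbb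 Q))\to H^1(G_{\mathbb Q},E'[\hat\phi])$ be the connecting homomorphism of $0\to E'[\hat\phi]\to E'(\overline{\mathbb Q})\to E(\overline{\mathbb Q})\to0$, which is well defined and sends the class of $P=\hat\phi(P')$ to the class of $\sigma\mapsto\sigma P'-P'$. For all $P\in E(\mathbb Q)$ and $T\in E[\phi]$, $$e_\phi(\cdot,T)_*\bigl(\delta_E(P)\bigr)=\kappa\bigl(b(P,T)\bigr)\quad\text{in }H^1(G_{\mathbb Q},\mu_4).$$ More precisely, for every $P'\in E'(\overline{\mathbb Q})$ with $\hat\phi(P')=P$ there are $d\in\mathbb Q^\times$ representing $b(P,T)$ and $\beta\in\overline{\mathbb Q}^\times$ with $\beta^4=d$ such that $e_\phi(\sigma P'-P',T)=\sigma(\beta)/\beta$ for all $\sigma\in G_{\mathbb Q}$. In particular $\delta_E(P)=\delta_{\mathbb Q}\bigl(b(P,T_0)\bigr)$. -/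

import Mathlib

open scoped WeierstrassCurve.Affine

noncomputable section

/-! ### Galois cohomology in degree one -/

section Cohomology

variable (G M : Type*) [Group G] [TopologicalSpace G] [AddCommGroup M] [DistribMulAction G M]

/-- Continuous crossed homomorphisms from `G` to the discrete `G`-module `M`
(continuity for the discrete topology on `M` is local constancy). -/
def ContCocycle : AddSubgroup (G → M) where
  carrier := {c | IsLocallyConstant c ∧ ∀ σ τ : G, c (σ * τ) = c σ + σ • c τ}
  zero_mem' := ⟨IsLocallyConstant.const 0, fun σ τ => by simp⟩
  add_mem' := fun {c d} hc hd => ⟨hc.1.add hd.1, fun σ τ => by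
    simp only [Pi.add_apply, hc.2, hd.2, smul_add]; abel⟩
  neg_mem' := fun {c} hc => ⟨hc.1.neg, fun σ τ => by
    simp only [Pi.neg_apply, hc.2, smul_neg]; abel⟩

/-- Principal crossed homomorphisms `σ ↦ σ m - m`. -/
def ContCoboundary : AddSubgroup (ContCocycle G M) where
  carrier := {c | ∃ m : M, ∀ σ : G, c.1 σ = σ • m - m}
  zero_mem' := ⟨0, fun σ => by simp⟩
  add_mem' := by
    rintro c d ⟨m, hm⟩ ⟨n, hn⟩
    refine ⟨m + n, fun σ => ?_⟩
    simp only [AddSubgroup.coe_add, Pi.add_apply, hm, hn, smul_add]; abel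
  neg_mem' := by
    rintro c ⟨m, hm⟩
    refine ⟨-m, fun σ => ?_⟩
    simp only [AddSubgroup.coe_neg, Pi.neg_apply, hm, smul_neg]; abel

/-- The first continuous cohomology group `H¹(G, M)` of a discrete `G`-module. -/
abbrev GalH1 : Type _ := ContCocycle G M ⧸ ContCoboundary G M

variable {G M}

/-- The cohomology class of a continuous crossed homomorphism. -/
def GalH1.mk (c : ContCocycle G M) : GalH1 G M := QuotientAddGroup.mk c

variable {N : Type*} [AddCommGroup N] [DistribMulAction G N]

/-- Composition of crossed homomorphisms with a homomorphism of `G`-modules. -/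
def ContCocycle.map (f : M →+[G] N) : ContCocycle G M →+ ContCocycle G N where
  toFun c := ⟨fun σ => f (c.1 σ), c.2.1.comp f, fun σ τ => by
    change f (c.1 (σ * τ)) = f (c.1 σ) + σ • f (c.1 τ)
    rw [c.2.2, map_add, map_smul]⟩
  map_zero' := by ext σ; exact map_zero f
  map_add' c d := by ext σ; exact map_add f _ _

/-- The homomorphism `H¹(G, M) → H¹(G, N)` induced by a homomorphism of `G`-modules `M → N`. -/
def GalH1.map (f : M →+[G] N) : GalH1 G M →+ GalH1 G N :=
  QuotientAddGroup.map _ _ (ContCocycle.map f) <| by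
    rintro c ⟨m, hm⟩
    refine ⟨f m, fun σ => ?_⟩
    change f (c.1 σ) = _
    rw [hm, map_sub, map_smul]

/-- The kernel of a homomorphism of `G`-modules. -/
abbrev equivKer (f : M →+[G] N) : AddSubgroup M := (f : M →+ N).ker

instance equivKerAction (f : M →+[G] N) : DistribMulAction G (equivKer f) where
  smul σ m := ⟨σ • m.1, by
    have h : f m.1 = 0 := m.2
    change f (σ • m.1) = 0
    rw [map_smul, h, smul_zero]⟩
  one_smul m := Subtype.ext (one_smul G m.1)
  mul_smul σ τ m := Subtype.ext (mul_smul σ τ m.1)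
  smul_zero σ := Subtype.ext (smul_zero σ)
  smul_add σ m n := Subtype.ext (smul_add σ m.1 n.1)

end Cohomology

/-! ### The Galois group of `ℚ` and its modules -/

/-- A fixed algebraic closure of `ℚ`. -/
abbrev Qbar : Type := AlgebraicClosure ℚ

/-- The absolute Galois group of `ℚ`, with its Krull topology. -/
abbrev GQ : Type := Gal(Qbar/ℚ)

instance : DecidableEq Qbar := Classical.decEq _

/-- The group `μ₄` of fourth roots of unity in `ℚ̄`, written additively. -/
abbrev Mu4 : Type := Additive (rootsOfUnity 4 Qbar)

/-- The Galois action on `μ₄`. -/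
instance mu4Action : DistribMulAction GQ Mu4 where
  smul σ ζ := Additive.ofMul (restrictRootsOfUnity σ 4 ζ.toMul)
  one_smul ζ := by
    apply Additive.toMul.injective; ext; rfl
  mul_smul σ τ ζ := by
    apply Additive.toMul.injective; ext; rfl
  smul_zero σ := map_one (restrictRootsOfUnity σ 4)
  smul_add σ ζ η := map_mul (restrictRootsOfUnity σ 4) ζ.toMul η.toMul

/-- The element of `ℚ̄` underlying a fourth root of unity. -/
def Mu4.val (ζ : Mu4) : Qbar := ((ζ.toMul : Qbarˣ) : Qbar)

/-- The group `ℚˣ / (ℚˣ)⁴`, written additively. -/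
abbrev QModFourth : Type := Additive (ℚˣ ⧸ (powMonoidHom 4 : ℚˣ →* ℚˣ).range)

/-- The class in `ℚˣ / (ℚˣ)⁴` of a nonzero rational number. -/
def QModFourth.mk (d : ℚˣ) : QModFourth := Additive.ofMul (QuotientGroup.mk d)

/-- `κ` is the connecting homomorphism `ℚˣ / (ℚˣ)⁴ → H¹(G_ℚ, μ₄)` of the Kummer sequence
`1 → μ₄ → ℚ̄ˣ → ℚ̄ˣ → 1`: the class of `d = β⁴` goes to the class of `σ ↦ σ(β) / β`. -/
def IsKummerMap (κ : QModFourth →+ GalH1 GQ Mu4) : Prop :=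
  ∀ (d : ℚˣ) (β : Qbar), β ^ 4 = algebraMap ℚ Qbar d →
    ∃ c : ContCocycle GQ Mu4, (∀ σ : GQ, (c.1 σ).val = σ β / β) ∧
      κ (QModFourth.mk d) = GalH1.mk c

/-- The Galois action on the `ℚ̄`-points of a Weierstrass curve over `ℚ`. -/
instance pointAction (W : WeierstrassCurve ℚ) : DistribMulAction GQ (W⁄Qbar).Point where
  smul σ P := WeierstrassCurve.Affine.Point.map (W' := W) σ.toAlgHom P
  one_smul P := by cases P <;> rfl
  mul_smul σ τ P := by cases P <;> rfl
  smul_zero σ := rfl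
  smul_add σ P Q := map_add (WeierstrassCurve.Affine.Point.map (W' := W) σ.toAlgHom) P Q

/-- The inclusion `W(ℚ) → W(ℚ̄)`. -/
def ratPoint (W : WeierstrassCurve ℚ) : (W⁄ℚ).Point →+ (W⁄Qbar).Point :=
  WeierstrassCurve.Affine.Point.baseChange (W' := W) ℚ Qbar

section Connecting

variable {W W' : WeierstrassCurve ℚ}

/-- The subgroup `ψ(W'(ℚ))` of `W(ℚ)`, for a Galois equivariant homomorphism
`ψ : W'(ℚ̄) → W(ℚ̄)`. -/
def ratImage (ψ : (W'⁄Qbar).Point →+[GQ] (W⁄Qbar).Point) : AddSubgroup (W⁄ℚ).Point :=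
  ((ratPoint W').range.map (ψ : (W'⁄Qbar).Point →+ (W⁄Qbar).Point)).comap (ratPoint W)

/-- `δ` is the connecting homomorphism `W(ℚ) / ψ(W'(ℚ)) → H¹(G_ℚ, ker ψ)` of the sequence
`0 → ker ψ → W'(ℚ̄) → W(ℚ̄) → 0`: the class of `P = ψ(P')` goes to the class of `σ ↦ σ P' - P'`. -/
def IsConnectingMap (ψ : (W'⁄Qbar).Point →+[GQ] (W⁄Qbar).Point)
    (δ : (W⁄ℚ).Point ⧸ ratImage ψ →+ GalH1 GQ (equivKer ψ)) : Prop :=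
  ∀ (P : (W⁄ℚ).Point) (P' : (W'⁄Qbar).Point), ψ P' = ratPoint W P →
    ∃ c : ContCocycle GQ (equivKer ψ),
      (∀ σ : GQ, ((c.1 σ : equivKer ψ) : (W'⁄Qbar).Point) = σ • P' - P') ∧
        δ (QuotientAddGroup.mk P) = GalH1.mk c

end Connecting

/-! ### The curves and the two isogenies -/

/-- The Weierstrass curve `y² + x y + c y = x³ + c x²`. -/
def tateCurve (c : ℚ) : WeierstrassCurve ℚ := ⟨1, c, c, 0, 0⟩

lemma tateCurve_nonsingular {F : Type*} [Field F] [Algebra ℚ F] {c : ℚ} (hc : c ≠ 0)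
    (hc' : 1 - 16 * c ≠ 0) {x y : F} :
    ((tateCurve c)⁄F).Nonsingular x y ↔
      y ^ 2 + x * y + (c : F) * y = x ^ 3 + (c : F) * x ^ 2 := by
  have : CharZero F := algebraRat.charZero F
  have hΔ : ((tateCurve c)⁄F).Δ ≠ 0 := by
    have h : (tateCurve c).Δ = c ^ 4 * (1 - 16 * c) := by
      simp only [tateCurve, WeierstrassCurve.Δ, WeierstrassCurve.b₂, WeierstrassCurve.b₄,
        WeierstrassCurve.b₆, WeierstrassCurve.b₈]
      ring
    change ((tateCurve c).map (algebraMap ℚ F)).Δ ≠ 0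
    rw [WeierstrassCurve.map_Δ, h]
    exact (map_ne_zero _).mpr (mul_ne_zero (pow_ne_zero _ hc) hc')
  rw [← WeierstrassCurve.Affine.equation_iff_nonsingular_of_Δ_ne_zero hΔ,
    WeierstrassCurve.Affine.equation_iff]
  simp [tateCurve]

section Curves

variable (t : ℚˣ)

/-- `a = -1 / (4 t²)`. -/
def coefE : ℚ := -1 / (4 * (t : ℚ) ^ 2)

/-- `A = (t² + 4) / 64`. -/
def coefE' : ℚ := ((t : ℚ) ^ 2 + 4) / 64

lemma coefE_ne : coefE t ≠ 0 :=
  div_ne_zero (by norm_num) (mul_ne_zero (by norm_num) (pow_ne_zero _ t.ne_zero))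

lemma coefE_ne' : 1 - 16 * coefE t ≠ 0 := by
  have h : 0 < (t : ℚ) ^ 2 := by have := t.ne_zero; positivity
  have h' : 1 - 16 * coefE t = 1 + 4 / (t : ℚ) ^ 2 := by
    have := t.ne_zero
    unfold coefE; field_simp; ring
  rw [h']; positivity

lemma coefE'_ne : coefE' t ≠ 0 := by
  unfold coefE'; positivity

lemma coefE'_ne' : 1 - 16 * coefE' t ≠ 0 := by
  have h : 1 - 16 * coefE' t = -((t : ℚ) ^ 2) / 4 := by unfold coefE'; ring
  rw [h]
  have := t.ne_zero
  simp

/-- The curve `E : y² + x y + a y = x³ + a x²` with `a = -1 / (4 t²)`. -/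
def curveE : WeierstrassCurve ℚ := tateCurve (coefE t)

/-- The curve `E' : Y² + X Y + A Y = X³ + A X²` with `A = (t² + 4) / 64`. -/
def curveE' : WeierstrassCurve ℚ := tateCurve (coefE' t)

/-- The group `E(ℚ)`. -/
abbrev PtEQ : Type := ((curveE t)⁄ℚ).Point
/-- The group `E(ℚ̄)`. -/
abbrev PtE : Type := ((curveE t)⁄Qbar).Point
/-- The group `E'(ℚ̄)`. -/
abbrev PtE' : Type := ((curveE' t)⁄Qbar).Point

lemma curveE_nonsingular {F : Type*} [Field F] [Algebra ℚ F] {x y : F} :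
    ((curveE t)⁄F).Nonsingular x y ↔
      y ^ 2 + x * y + (coefE t : F) * y = x ^ 3 + (coefE t : F) * x ^ 2 :=
  tateCurve_nonsingular (coefE_ne t) (coefE_ne' t)

lemma curveE'_nonsingular {F : Type*} [Field F] [Algebra ℚ F] {x y : F} :
    ((curveE' t)⁄F).Nonsingular x y ↔
      y ^ 2 + x * y + (coefE' t : F) * y = x ^ 3 + (coefE' t : F) * x ^ 2 :=
  tateCurve_nonsingular (coefE'_ne t) (coefE'_ne' t)

lemma four_sq_coefE : 4 * (t : Qbar) ^ 2 * (coefE t : Qbar) = -1 := by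
  have h : 4 * (t : ℚ) ^ 2 * coefE t = -1 := by
    have := t.ne_zero
    unfold coefE; field_simp
  exact_mod_cast h

lemma coefE'_eq : 64 * (coefE' t : Qbar) = (t : Qbar) ^ 2 + 4 := by
  have h : 64 * coefE' t = (t : ℚ) ^ 2 + 4 := by unfold coefE'; ring
  exact_mod_cast h

/-- The `X`-coordinate of `φ(x, y)`. -/
def phiX (x y : Qbar) : Qbar :=
  -(coefE' t : Qbar) +
    ((t : Qbar) * (x + 2 * coefE t) * (2 * y + x + coefE t) / (8 * x * (x + coefE t))) ^ 2

/-- The `Y`-coordinate of `φ(x, y)`. -/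
def phiY (x y : Qbar) : Qbar :=
  phiX t x y ^ 2 - (x + coefE t) ^ 2 *
    (((2 * y + x + coefE t) - 2 * (t : Qbar) * x * (x + 2 * coefE t)) /
      (8 * x * (x + coefE t))) ^ 4

/-- The `x`-coordinate of `φ̂(X, Y)`. -/
def dualX (X Y : Qbar) : Qbar :=
  -(coefE t : Qbar) +
    (X * (2 * Y + X + coefE' t) / (2 * (t : Qbar) * (X + coefE' t) * (X + 2 * coefE' t))) ^ 2

/-- The `y`-coordinate of `φ̂(X, Y)`. -/
def dualY (X Y : Qbar) : Qbar :=
  dualX t X Y ^ 2 -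
    ((2 * (X + 2 * coefE' t) * (2 * Y + X + coefE' t) - (t : Qbar) * X * (X + coefE' t)) /
      (4 * (t : Qbar) * (X + coefE' t) * (X + 2 * coefE' t))) ^ 4

lemma equation_of_sq {F : Type*} [Field F] {c x r K : F} (h1 : x + c = r ^ 2)
    (h2 : x ^ 2 = K ^ 2 + K * r) :
    (x ^ 2 - K ^ 2) ^ 2 + x * (x ^ 2 - K ^ 2) + c * (x ^ 2 - K ^ 2) = x ^ 3 + c * x ^ 2 := by
  linear_combination (x ^ 2 + K * r - K ^ 2) * h2 - K ^ 2 * h1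

lemma phi_nonsingular {x y : Qbar} (h : ((curveE t)⁄Qbar).Nonsingular x y)
    (h0 : x * (x + coefE t) ≠ 0) :
    ((curveE' t)⁄Qbar).Nonsingular (phiX t x y) (phiY t x y) := by
  rw [curveE_nonsingular] at h
  rw [curveE'_nonsingular]
  have hx : x ≠ 0 := left_ne_zero_of_mul h0
  have hxa : x + (coefE t : Qbar) ≠ 0 := right_ne_zero_of_mul h0
  have ht : (t : Qbar) ≠ 0 := by exact_mod_cast t.ne_zero
  have ha := four_sq_coefE t
  have hA := coefE'_eq t
  unfold phiY phiX
  generalize (coefE t : Qbar) = a at *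
  generalize (coefE' t : Qbar) = A at *
  generalize ((t : ℚ) : Qbar) = s at *
  set R := s * (x + 2 * a) * (2 * y + x + a) / (8 * x * (x + a)) with hR
  set K := (x + a) * (((2 * y + x + a) - 2 * s * x * (x + 2 * a)) / (8 * x * (x + a))) ^ 2 with hK
  have e := equation_of_sq (c := A) (x := -A + R ^ 2) (r := R) (K := K) (by ring) ?_
  · have hK2 : (x + a) ^ 2 * (((2 * y + x + a) - 2 * s * x * (x + 2 * a)) /
        (8 * x * (x + a))) ^ 4 = K ^ 2 := by rw [hK]; ring
    rw [hK2]; exact e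
  · obtain ⟨v, hv⟩ : ∃ v, v = 2 * y + x + a := ⟨_, rfl⟩
    have hv2 : v ^ 2 = (x + a) * (4 * x ^ 2 + x + a) := by rw [hv]; linear_combination 4 * h
    rw [← hv] at hR hK
    have e1 : K ^ 2 + K * R =
        ((v ^ 2 - 4 * s ^ 2 * x ^ 2 * (x + 2 * a) ^ 2) / (64 * x ^ 2 * (x + a))) ^ 2 := by
      rw [hR, hK]; field_simp; ring
    have e2 : -A + R ^ 2 =
        -((v ^ 2 - 4 * s ^ 2 * x ^ 2 * (x + 2 * a) ^ 2) / (64 * x ^ 2 * (x + a))) := by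
      have hA' : A = (s ^ 2 + 4) / 64 := by rw [← hA]; ring
      rw [hR, hA']
      have : (s * (x + 2 * a) * v / (8 * x * (x + a))) ^ 2 =
          s ^ 2 * (x + 2 * a) ^ 2 * (4 * x ^ 2 + x + a) / (64 * x ^ 2 * (x + a)) := by
        rw [div_pow, mul_pow, hv2]; field_simp; ring
      rw [this, hv2]
      field_simp
      linear_combination (x + a) ^ 2 * ha
    rw [e1, e2]; ring

lemma dual_nonsingular {X Y : Qbar} (h : ((curveE' t)⁄Qbar).Nonsingular X Y)
    (h0 : (X + coefE' t) * (X + 2 * coefE' t) ≠ 0) :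
    ((curveE t)⁄Qbar).Nonsingular (dualX t X Y) (dualY t X Y) := by
  rw [curveE'_nonsingular] at h
  rw [curveE_nonsingular]
  have hX : X + (coefE' t : Qbar) ≠ 0 := left_ne_zero_of_mul h0
  have hX2 : X + 2 * (coefE' t : Qbar) ≠ 0 := right_ne_zero_of_mul h0
  have ht : (t : Qbar) ≠ 0 := by exact_mod_cast t.ne_zero
  have ha := four_sq_coefE t
  have hA := coefE'_eq t
  unfold dualY dualX
  generalize (coefE t : Qbar) = a at *
  generalize (coefE' t : Qbar) = A at *
  generalize ((t : ℚ) : Qbar) = s at *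
  set r := X * (2 * Y + X + A) / (2 * s * (X + A) * (X + 2 * A)) with hr
  set g := (2 * (X + 2 * A) * (2 * Y + X + A) - s * X * (X + A)) /
    (4 * s * (X + A) * (X + 2 * A)) with hg
  have e := equation_of_sq (c := a) (x := -a + r ^ 2) (r := r) (K := g ^ 2) (by ring) ?_
  · have hg4 : g ^ 4 = (g ^ 2) ^ 2 := by ring
    rw [hg4]; exact e
  · obtain ⟨u, hu⟩ : ∃ u, u = 2 * Y + X + A := ⟨_, rfl⟩
    have hu2 : u ^ 2 = (X + A) * (4 * X ^ 2 + X + A) := by rw [hu]; linear_combination 4 * h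
    rw [← hu] at hr hg
    obtain ⟨v, hv⟩ : ∃ v, u = (X + A) * v := ⟨u / (X + A), by field_simp⟩
    have hv2 : v ^ 2 * (X + A) = 4 * X ^ 2 + X + A := by
      apply mul_left_cancel₀ hX
      rw [← hu2, hv]; ring
    have hr' : r = X * v / (2 * s * (X + 2 * A)) := by rw [hr, hv]; field_simp
    have hg' : g = (2 * (X + 2 * A) * v - s * X) / (4 * s * (X + 2 * A)) := by
      rw [hg, hv]; field_simp
    have e1 : (g ^ 2) ^ 2 + g ^ 2 * r =
        ((4 * (X + 2 * A) ^ 2 * v ^ 2 - s ^ 2 * X ^ 2) / (16 * s ^ 2 * (X + 2 * A) ^ 2)) ^ 2 := by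
      rw [hr', hg']; field_simp; ring
    have ha' : a = -1 / (4 * s ^ 2) := by rw [← ha]; field_simp
    have e2 : -a + r ^ 2 =
        (4 * (X + 2 * A) ^ 2 * v ^ 2 - s ^ 2 * X ^ 2) / (16 * s ^ 2 * (X + 2 * A) ^ 2) := by
      rw [hr', ha']; field_simp
      linear_combination (-256 * A) * hv2 - 16 * X ^ 2 * hA
    rw [e1, e2]

/-- The isogeny `φ : E → E'`, on points over `ℚ̄`. -/
def phiFun : PtE t → PtE' t
  | .zero => 0
  | .some x _ h =>
    if h0 : x * (x + coefE t) = 0 then 0 else .some _ _ (phi_nonsingular t h h0)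

/-- The dual isogeny `φ̂ : E' → E`, on points over `ℚ̄`. -/
def dualFun : PtE' t → PtE t
  | .zero => 0
  | .some X _ h =>
    if h0 : (X + coefE' t) * (X + 2 * coefE' t) = 0 then 0
    else .some _ _ (dual_nonsingular t h h0)

/-- Multiplication by `4` on `E(ℚ̄)`; its kernel is `E[4]`. -/
def mulFour : PtE t →+[GQ] PtE t where
  toFun P := 4 • P
  map_smul' σ P := (map_nsmul (DistribSMul.toAddMonoidHom (PtE t) σ) 4 P).symm
  map_zero' := smul_zero 4
  map_add' P Q := smul_add 4 P Q

/-- The point `(0, 0)` of `E` over `ℚ̄`. -/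
def originPt : PtE t :=
  .some 0 0 ((curveE_nonsingular t).mpr (by ring))

/-- The point `(-2 A, A (2 + i t) / 4)` of `E'`, where `i` is a square root of `-1`. -/
def dualTorsionPt (i : Qbar) (hi : i ^ 2 = -1) : PtE' t :=
  .some (-2 * (coefE' t : Qbar)) ((coefE' t : Qbar) * ((2 + i * (t : Qbar)) / 4))
    ((curveE'_nonsingular t).mpr (by
      have hA := coefE'_eq t
      generalize (coefE' t : Qbar) = A at *
      linear_combination (A ^ 2 * (t : Qbar) ^ 2 / 16) * hi + A ^ 2 / 16 * hA))

/-- The function `x² - y` on `E(ℚ)`, with the value `a⁻¹` at its zero `(0, 0)` and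
the value `1` at its pole `𝓞`. -/
def descentValue : PtEQ t → ℚˣ
  | .zero => 1
  | .some x y h =>
    if h0 : x = 0 ∧ y = 0 then (Units.mk0 (coefE t) (coefE_ne t))⁻¹
    else Units.mk0 (x ^ 2 - y) (by
      intro hxy
      have e := (curveE_nonsingular t).mp h
      have hy : y = x ^ 2 := by linear_combination -hxy
      subst hy
      have hx : x ^ 4 = 0 := by linear_combination e
      have hx' : x = 0 := by simpa using hx
      exact h0 ⟨hx', by simp [hx']⟩)

end Curves

end

/-!
The isogeny `φ̂` is cyclic of degree `4`, and factors as
`E' → midCurve A ≃ midCurve a → E`, a 2-isogeny, an isomorphism and the dual of a 2-isogeny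
(`dualFun_eq`); likewise `φ` (`phiFun_eq`). This gives the composites `[4]` and surjectivity, and
additivity as well. A 2-isogeny is additive on `P` and `R` by a computation with the line through
them, as long as `R` avoids finitely many points, and this is enough, because additivity at generic
pairs implies additivity (`add_of_generic`).

The descent rests on one function. The pullback of `x² - y` along `φ̂` is the fourth power of a
rational function `dualRoot` on `E'`, defined over `ℚ` (`dualRoot_pow_four`), and translation by the
generator `Q_i = (-2 A, A (2 + i t) / 4)` of `E'[φ̂]` multiplies `dualRoot` by `i`
(`dualRoot_add_dualTorsionPt`). Hence the translations by `E'[φ̂]` act on `dualRoot` through an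
isomorphism of Galois modules `w : E'[φ̂] ≃ μ₄` (`exists_weilHom`). As the Galois action on
`E[φ] = ⟨T₀⟩` is trivial, the pairing is `e_φ(T', m T₀) = m w(T')`. To see that it is alternating,
consider `E[4]` as an extension of `μ₄` by `E[φ]` through `w ∘ φ`: the determinant in coordinates
adapted to this extension is an alternating Galois invariant form
(`exists_alternating_of_extension`).

If `φ̂(P') = P` and `β` is the value of `dualRoot` at `P'`, then `β⁴ = (x² - y)(P)` and
`σ(β) / β = w(σ P' - P')`, since `σ P'` is the translate of `P'` by `σ P' - P'`. So `w` maps the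
connecting homomorphism `δ_E` to the Kummer class of `(x² - y)(P)` (`map_connectingMap`); the
exceptional value at `(0, 0)` follows from the value `a` at `-(0, 0)`. The Kummer map is an
isomorphism by Hilbert's Theorem 90 (`exists_kummerMap`), and `δ_E` is injective because a Galois
invariant point is rational (`exists_connectingMap`). The pairing `b` is therefore obtained by
transporting `δ_E` along `w` and the Kummer map: that it is well defined, bilinear and
non-degenerate on the left comes from `δ_E`, and the formula from the function `x² - y`.
-/

noncomputable section

open WeierstrassCurve.Affine

/-! ### Additivity from additivity at generic pairs -/

/-- A map that is additive on all pairs `(P, R)` with `R` outside a finite set depending on `P` is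
additive: `f (P + Q) + f R`, `f (P + Q + R)`, `f P + f (Q + R)` and `f P + f Q + f R` agree for all
but finitely many `R`. -/
lemma add_of_generic {A B : Type*} [AddGroup A] [AddGroup B] [Infinite A] (f : A → B)
    (S : A → Set A) (hS : ∀ P, (S P).Finite) (h : ∀ P R, R ∉ S P → f (P + R) = f P + f R)
    (P Q : A) : f (P + Q) = f P + f Q := by
  have h1 : ((fun R => Q + R) ⁻¹' S P).Finite :=
    (hS P).preimage (add_right_injective Q).injOn
  obtain ⟨R, hR⟩ := (((hS (P + Q)).union (hS Q)).union h1).exists_notMem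
  simp only [Set.mem_union, not_or] at hR
  have e1 := h _ _ hR.1.1
  have e2 := h _ _ hR.1.2
  have e3 := h P (Q + R) hR.2
  rw [add_assoc, e3, e2, ← add_assoc] at e1
  exact (add_right_cancel e1).symm

namespace WeierstrassCurve.Affine

variable {K : Type*} [Field K]

lemma finite_setOf_xRep_mem (W : Affine K) {s : Set (Fin 2 → K)} (hs : s.Finite) :
    {P : W.Point | P.xRep ∈ s}.Finite := by
  refine hs.preimage' fun b _ => ?_
  by_cases h : ∃ P : W.Point, P.xRep = b
  · obtain ⟨P, rfl⟩ := h
    refine (Set.toFinite {P, -P}).subset fun Q hQ => ?_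
    exact Point.eq_or_eq_neg_of_xRep_eq_xRep hQ
  · convert Set.finite_empty
    ext Q
    simpa using fun hQ => h ⟨Q, hQ⟩

lemma exists_equation [IsAlgClosed K] (W : Affine K) (x : K) : ∃ y, W.Equation x y := by
  obtain ⟨y, hy⟩ := IsAlgClosed.exists_root
    (Polynomial.X ^ 2 + Polynomial.C (W.a₁ * x + W.a₃) * Polynomial.X +
      Polynomial.C (-(x ^ 3 + W.a₂ * x ^ 2 + W.a₄ * x + W.a₆))) (by
        have : (Polynomial.X ^ 2 + Polynomial.C (W.a₁ * x + W.a₃) * Polynomial.X +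
          Polynomial.C (-(x ^ 3 + W.a₂ * x ^ 2 + W.a₄ * x + W.a₆)) : Polynomial K).degree = 2 := by
            compute_degree!
        rw [this]; decide)
  refine ⟨y, (W.equation_iff x y).mpr ?_⟩
  simp only [Polynomial.IsRoot, Polynomial.eval_add, Polynomial.eval_mul, Polynomial.eval_pow,
    Polynomial.eval_X, Polynomial.eval_C] at hy
  linear_combination hy

lemma infinite_point [IsAlgClosed K] (W : Affine K)
    (hW : ∀ x y, W.Equation x y → W.Nonsingular x y) :
    Infinite W.Point := by
  have : Infinite K := IsAlgClosed.instInfinite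
  choose y hy using exists_equation W
  refine Infinite.of_injective (fun x : K => Point.some x (y x) (hW _ _ (hy x))) fun x x' h => ?_
  simpa using (Point.some.inj h).1

lemma some_congr {W : Affine K} {x y x' y' : K} {h : W.Nonsingular x y} {h' : W.Nonsingular x' y'}
    (hx : x = x') (hy : y = y') : Point.some x y h = Point.some x' y' h' := by
  subst hx hy
  rfl

lemma exists_some_eq {W : Affine K} {x y x' y' : K} (h : W.Nonsingular x y) (hx : x = x')
    (hy : y = y') : ∃ h', Point.some x y h = Point.some x' y' h' := by
  subst hx hy
  exact ⟨h, rfl⟩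

/-! ### Affine changes of coordinates -/

section AffineChange

variable {W V : Affine K} (p q r s t : K)

/-- The map on points `(x, y) ↦ (p x + r, q y + s x + t)`. -/
def affineMap (hns : ∀ x y, W.Nonsingular x y → V.Nonsingular (p * x + r) (q * y + s * x + t)) :
    W.Point → V.Point
  | .zero => 0
  | .some x y h => .some _ _ (hns x y h)

lemma affineMap_add [DecidableEq K] [IsAlgClosed K] [Infinite W.Point] (hp : p ≠ 0)
    (h3 : p ^ 3 = q ^ 2) (h1 : 2 * s + V.a₁ * p = q * W.a₁)
    (h3' : 2 * t + V.a₁ * r + V.a₃ = q * W.a₃)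
    (h2 : 3 * p ^ 2 * r + V.a₂ * p ^ 2 - s ^ 2 - V.a₁ * p * s = q ^ 2 * W.a₂)
    (hns : ∀ x y, W.Nonsingular x y → V.Nonsingular (p * x + r) (q * y + s * x + t))
    (P Q : W.Point) :
    affineMap p q r s t hns (P + Q) = affineMap p q r s t hns P + affineMap p q r s t hns Q := by
  refine add_of_generic _ (fun P => {R | R.xRep ∈ ({![1, 0], P.xRep} : Set (Fin 2 → K))})
    (fun P => finite_setOf_xRep_mem W (Set.toFinite _)) ?_ P Q
  rintro (_ | ⟨x₁, y₁, hP⟩) R hR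
  · rw [← Point.zero_def, zero_add]
    exact (zero_add _).symm
  rcases R with _ | ⟨x₂, y₂, hQ⟩
  · exact absurd (by simp [← Point.zero_def]) hR
  have hx : x₁ ≠ x₂ := by
    rintro rfl
    exact hR (by simp)
  have hx' : p * x₁ + r ≠ p * x₂ + r := by simpa [hp] using hx
  rw [Point.add_of_X_ne hx]
  simp only [affineMap]
  rw [Point.add_of_X_ne hx']
  have hs : V.slope (p * x₁ + r) (p * x₂ + r) (q * y₁ + s * x₁ + t) (q * y₂ + s * x₂ + t) =
      (q * W.slope x₁ x₂ y₁ y₂ + s) / p := by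
    rw [slope_of_X_ne hx, slope_of_X_ne hx']
    have h := sub_ne_zero.mpr hx
    have h' : p * x₁ + r - (p * x₂ + r) = p * (x₁ - x₂) := by ring
    rw [h']
    field_simp
    ring
  have hX : p * W.addX x₁ x₂ (W.slope x₁ x₂ y₁ y₂) + r =
      V.addX (p * x₁ + r) (p * x₂ + r) ((q * W.slope x₁ x₂ y₁ y₂ + s) / p) := by
    generalize W.slope x₁ x₂ y₁ y₂ = l
    simp only [addX]
    field_simp
    linear_combination (l ^ 2 + W.a₁ * l - W.a₂) * h3 + h2 - q * l * h1
  rw [Point.some.injEq, hs, addY, addY, negAddY, negAddY, ← hX, negY, negY]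
  refine ⟨rfl, ?_⟩
  generalize W.addX x₁ x₂ (W.slope x₁ x₂ y₁ y₂) = x₃
  generalize W.slope x₁ x₂ y₁ y₂ = l
  field_simp
  linear_combination p * (x₃ * h1 + h3')

lemma affineMap_surjective (hp : p ≠ 0) (hq : q ≠ 0)
    (hns : ∀ x y, W.Nonsingular x y → V.Nonsingular (p * x + r) (q * y + s * x + t))
    (hns' : ∀ x y, V.Nonsingular (p * x + r) (q * y + s * x + t) → W.Nonsingular x y) :
    Function.Surjective (affineMap p q r s t hns) := by
  rintro (_ | ⟨x, y, h⟩)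
  · exact ⟨0, rfl⟩
  · have hx : p * ((x - r) / p) + r = x := by field_simp; ring
    have hy : q * ((y - s * ((x - r) / p) - t) / q) + s * ((x - r) / p) + t = y := by
      field_simp; ring
    refine ⟨.some _ _ (hns' _ _ (by rwa [hy, hx])), ?_⟩
    simp only [affineMap, Point.some.injEq]
    exact ⟨hx, hy⟩

end AffineChange

end WeierstrassCurve.Affine

namespace WeierstrassCurve.Affine
variable {K : Type*} [Field K]

/-! ### The 2-isogeny with kernel generated by `(0, 0)` -/

/-- The curve `y² = x³ + α x² + β x`, with the marked point `(0, 0)` of order `2`. -/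
def twoTorsionCurve (α β : K) : Affine K := ⟨0, α, 0, β, 0⟩

lemma twoTorsionCurve_nonsingular [CharZero K] {α β : K} (h : β * (α ^ 2 - 4 * β) ≠ 0) {x y : K} :
    (twoTorsionCurve α β).Nonsingular x y ↔ y ^ 2 = x ^ 3 + α * x ^ 2 + β * x := by
  have hΔ : (twoTorsionCurve α β).Δ ≠ 0 := by
    have e : (twoTorsionCurve α β).Δ = 16 * β * (β * (α ^ 2 - 4 * β)) := by
      simp only [twoTorsionCurve, WeierstrassCurve.Δ, WeierstrassCurve.b₂, WeierstrassCurve.b₄,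
        WeierstrassCurve.b₆, WeierstrassCurve.b₈]
      ring
    rw [e]
    exact mul_ne_zero (mul_ne_zero (by norm_num) (left_ne_zero_of_mul h)) h
  rw [← equation_iff_nonsingular_of_Δ_ne_zero hΔ, equation_iff]
  simp [twoTorsionCurve]

/-- If the line `y = l x + ν` meets `y² = x³ + α x² + β x` at the abscissas `x₁, x₂, x₃`, these are
the roots of a cubic polynomial, whose coefficients give two relations. -/
lemma chord_relations {α β x₁ x₂ x₃ l ν : K} (hx : x₁ ≠ x₂)
    (h₁ : (l * x₁ + ν) ^ 2 = x₁ ^ 3 + α * x₁ ^ 2 + β * x₁)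
    (h₂ : (l * x₂ + ν) ^ 2 = x₂ ^ 3 + α * x₂ ^ 2 + β * x₂)
    (h₃ : x₃ = l ^ 2 - α - x₁ - x₂) :
    β = 2 * l * ν + x₁ * x₂ + x₃ * (x₁ + x₂) ∧ ν ^ 2 = x₁ * x₂ * x₃ := by
  have hβ : β = 2 * l * ν + x₁ * x₂ + x₃ * (x₁ + x₂) := by
    apply mul_left_cancel₀ (sub_ne_zero.mpr hx)
    rw [h₃]
    linear_combination h₂ - h₁
  refine ⟨hβ, ?_⟩
  rw [hβ, h₃] at h₁
  rw [h₃]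
  linear_combination h₁

/-- Under the 2-isogeny, the points of the line `y = l x + ν` on `y² = x³ + α x² + β x` go to points
of the line with slope `(ν l - β) / ν`. -/
lemma chord_image {α β x₁ x₂ x₃ l ν : K} (h₁ : x₁ ≠ 0) (h₂ : x₂ ≠ 0) (hν : ν ≠ 0)
    (h₃ : x₃ = l ^ 2 - α - x₁ - x₂) (hβ : β = 2 * l * ν + x₁ * x₂ + x₃ * (x₁ + x₂))
    (hν2 : ν ^ 2 = x₁ * x₂ * x₃) :
    (l * x₁ + ν) * (x₁ ^ 2 - β) / x₁ ^ 2 = (ν * l - β) / ν * ((l * x₁ + ν) ^ 2 / x₁ ^ 2) +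
      (ν ^ 2 - α * ν * l + β * l ^ 2) / ν := by
  obtain rfl : x₃ = ν ^ 2 / (x₁ * x₂) := by rw [hν2]; field_simp
  obtain rfl : α = l ^ 2 - x₁ - x₂ - ν ^ 2 / (x₁ * x₂) := by rw [h₃]; ring
  subst hβ
  field_simp
  ring

/-- The abscissa of the image of the third point of a chord is that of the third point on the chord
of the images. -/
lemma chord_image_addX {α β x₁ x₂ x₃ l ν : K} (h₁ : x₁ ≠ 0) (h₂ : x₂ ≠ 0) (hν : ν ≠ 0)
    (h₃ : x₃ = l ^ 2 - α - x₁ - x₂) (hβ : β = 2 * l * ν + x₁ * x₂ + x₃ * (x₁ + x₂))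
    (hν2 : ν ^ 2 = x₁ * x₂ * x₃) :
    (l * x₃ + ν) ^ 2 / x₃ ^ 2 = ((ν * l - β) / ν) ^ 2 + 2 * α -
      (l * x₁ + ν) ^ 2 / x₁ ^ 2 - (l * x₂ + ν) ^ 2 / x₂ ^ 2 := by
  obtain rfl : x₃ = ν ^ 2 / (x₁ * x₂) := by rw [hν2]; field_simp
  obtain rfl : α = l ^ 2 - x₁ - x₂ - ν ^ 2 / (x₁ * x₂) := by rw [h₃]; ring
  subst hβ
  field_simp
  ring

section TwoIsogeny

variable [CharZero K] {α β α' β' : K} (h : β * (α ^ 2 - 4 * β) ≠ 0) (hα : α' = -2 * α)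
  (hβ : β' = α ^ 2 - 4 * β)

include h hα hβ in
lemma twoIsog_disc_ne_zero : β' * (α' ^ 2 - 4 * β') ≠ 0 := by
  have e : β' * (α' ^ 2 - 4 * β') = 16 * (β * (α ^ 2 - 4 * β)) := by subst hα hβ; ring
  rw [e]
  exact mul_ne_zero (by norm_num) h

include h hα hβ in
lemma twoIsog_nonsingular {x y : K} (hxy : (twoTorsionCurve α β).Nonsingular x y) (hx : x ≠ 0) :
    (twoTorsionCurve α' β').Nonsingular (y ^ 2 / x ^ 2) (y * (x ^ 2 - β) / x ^ 2) := by
  rw [twoTorsionCurve_nonsingular h] at hxy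
  rw [twoTorsionCurve_nonsingular (twoIsog_disc_ne_zero h hα hβ), div_pow, mul_pow, hxy]
  subst hα hβ
  field_simp
  ring

/-- The 2-isogeny `(x, y) ↦ (y² / x², y (x² - β) / x²)` from `y² = x³ + α x² + β x` to
`y² = x³ + α' x² + β' x`, where `α' = -2 α` and `β' = α² - 4 β`. -/
def twoIsogFun [DecidableEq K] : (twoTorsionCurve α β).Point → (twoTorsionCurve α' β').Point
  | .zero => 0
  | .some x _ hxy => if hx : x = 0 then 0 else .some _ _ (twoIsog_nonsingular h hα hβ hxy hx)

lemma twoIsogFun_some [DecidableEq K] {x y : K}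
    (hxy : (twoTorsionCurve α β).Nonsingular x y) (hx : x ≠ 0) :
    twoIsogFun h hα hβ (.some x y hxy) = .some _ _ (twoIsog_nonsingular h hα hβ hxy hx) := by
  simp [twoIsogFun, hx]

lemma twoTorsionCurve_infinite_point [IsAlgClosed K] (h : β * (α ^ 2 - 4 * β) ≠ 0) :
    Infinite (twoTorsionCurve α β).Point :=
  infinite_point _ fun x y hxy => by
    rw [twoTorsionCurve_nonsingular h]
    simpa [equation_iff, twoTorsionCurve] using hxy

variable [DecidableEq K]

lemma twoIsogFun_add [IsAlgClosed K] (P Q : (twoTorsionCurve α β).Point) :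
    twoIsogFun h hα hβ (P + Q) = twoIsogFun h hα hβ P + twoIsogFun h hα hβ Q := by
  have := twoTorsionCurve_infinite_point h
  refine add_of_generic _ (fun P => {R | R.xRep ∈
    ({![1, 0], ![0, 1], P.xRep, ![β / P.xRep 0, 1]} : Set (Fin 2 → K))})
    (fun P => finite_setOf_xRep_mem _ (Set.toFinite _)) ?_ P Q
  rintro (_ | ⟨x₁, y₁, hP⟩) R hR
  · rw [← Point.zero_def, zero_add]
    exact (zero_add _).symm
  rcases R with _ | ⟨x₂, y₂, hQ⟩
  · exact absurd (by simp [← Point.zero_def]) hR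
  simp only [Point.xRep_some, Set.mem_insert_iff, Set.mem_singleton_iff, Set.mem_ofPred_eq, not_or,
    Matrix.cons_val_zero] at hR
  obtain ⟨-, hx₂, hx, hx'⟩ := hR
  replace hx₂ : x₂ ≠ 0 := by rintro rfl; exact hx₂ rfl
  replace hx : x₁ ≠ x₂ := by rintro rfl; exact hx rfl
  replace hx' : x₂ ≠ β / x₁ := by rintro rfl; exact hx' rfl
  have e₁ := (twoTorsionCurve_nonsingular h).mp hP
  have e₂ := (twoTorsionCurve_nonsingular h).mp hQ
  have hβ0 : β ≠ 0 := left_ne_zero_of_mul h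
  rw [Point.add_of_X_ne hx]
  have hs := slope_of_X_ne (W := twoTorsionCurve α β) (y₁ := y₁) (y₂ := y₂) hx
  have hl : (twoTorsionCurve α β).slope x₁ x₂ y₁ y₂ * (x₁ - x₂) = y₁ - y₂ := by
    rw [hs, div_mul_cancel₀ _ (sub_ne_zero.mpr hx)]
  obtain ⟨l, hl'⟩ : ∃ l, l = (twoTorsionCurve α β).slope x₁ x₂ y₁ y₂ := ⟨_, rfl⟩
  have hX : (twoTorsionCurve α β).addX x₁ x₂ l = l ^ 2 - α - x₁ - x₂ := by
    simp [addX, twoTorsionCurve]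
  have hY : (twoTorsionCurve α β).addY x₁ x₂ y₁ l =
      -(l * ((twoTorsionCurve α β).addX x₁ x₂ l) + (y₁ - l * x₁)) := by
    simp [addY, negAddY, negY, twoTorsionCurve]; ring
  obtain ⟨x₃, hx₃⟩ : ∃ x₃, x₃ = (twoTorsionCurve α β).addX x₁ x₂ l := ⟨_, rfl⟩
  rw [← hl'] at hl
  obtain ⟨ν, hν⟩ : ∃ ν, ν = y₁ - l * x₁ := ⟨_, rfl⟩
  have hy₁ : y₁ = l * x₁ + ν := by rw [hν]; ring
  have hy₂ : y₂ = l * x₂ + ν := by linear_combination hl - hν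
  rw [hy₁] at e₁
  rw [hy₂] at e₂
  rw [← hx₃] at hX
  obtain ⟨r₁, r₂⟩ := chord_relations hx e₁ e₂ hX
  by_cases hx₁ : x₁ = 0
  · have hν0 : ν = 0 := by simpa [hx₁] using r₂
    have hx₃' : x₃ = β / x₂ := by
      rw [r₁, hν0, hx₁]; field_simp; ring
    have hx₃0 : x₃ ≠ 0 := by rw [hx₃']; exact div_ne_zero hβ0 hx₂
    have h0 : twoIsogFun h hα hβ (.some x₁ y₁ hP) = 0 := by simp [twoIsogFun, hx₁]
    rw [twoIsogFun_some (hx := by rwa [← hl', ← hx₃]), h0, zero_add,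
      twoIsogFun_some (hx := hx₂), Point.some.injEq, ← hl', hY, ← hx₃, ← hν, hy₂, hν0]
    constructor
    · field_simp; ring
    · rw [hx₃']; field_simp; ring
  · have key : y₁ ^ 2 * x₂ ^ 2 ≠ y₂ ^ 2 * x₁ ^ 2 := by
      intro e
      rw [hy₁, hy₂, e₁, e₂] at e
      have : (x₁ - x₂) * (x₁ * x₂) * (x₁ * x₂ - β) = 0 := by linear_combination e
      rcases mul_eq_zero.mp this with h' | h'
      · simp [sub_ne_zero.mpr hx, hx₁, hx₂] at h'
      · apply hx'
        field_simp
        linear_combination h'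
    have hν0 : ν ≠ 0 := by
      rintro rfl
      apply key
      rw [hy₁, hy₂]; ring
    have hx₃0 : x₃ ≠ 0 := by
      rintro rfl
      apply hν0
      simpa using r₂
    have hXX : y₁ ^ 2 / x₁ ^ 2 ≠ y₂ ^ 2 / x₂ ^ 2 := by
      rw [Ne, div_eq_div_iff (pow_ne_zero 2 hx₁) (pow_ne_zero 2 hx₂)]
      exact key
    rw [twoIsogFun_some (hx := by rwa [← hl', ← hx₃]), twoIsogFun_some (hx := hx₁),
      twoIsogFun_some (hx := hx₂), Point.add_of_X_ne hXX]
    have l₁ := chord_image hx₁ hx₂ hν0 hX r₁ r₂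
    have l₂ := chord_image (α := α) (β := β) (l := l) (x₃ := x₃) hx₂ hx₁ hν0
      (by linear_combination hX)
      (by linear_combination r₁) (by linear_combination r₂)
    have l₃ := chord_image (α := α) (β := β) (l := l) (x₃ := x₂) hx₃0 hx₁ hν0
      (by linear_combination hX)
      (by linear_combination r₁) (by linear_combination r₂)
    have lX := chord_image_addX hx₁ hx₂ hν0 hX r₁ r₂
    rw [← hy₁] at l₁ lX
    rw [← hy₂] at l₂ lX
    have hS : (twoTorsionCurve α' β').slope (y₁ ^ 2 / x₁ ^ 2) (y₂ ^ 2 / x₂ ^ 2)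
        (y₁ * (x₁ ^ 2 - β) / x₁ ^ 2) (y₂ * (x₂ ^ 2 - β) / x₂ ^ 2) = (ν * l - β) / ν := by
      rw [slope_of_X_ne hXX, div_eq_iff (sub_ne_zero.mpr hXX), l₁, l₂]
      ring
    have hXX3 : (twoTorsionCurve α' β').addX (y₁ ^ 2 / x₁ ^ 2) (y₂ ^ 2 / x₂ ^ 2)
        ((ν * l - β) / ν) = (l * x₃ + ν) ^ 2 / x₃ ^ 2 := by
      rw [lX]; simp [addX, twoTorsionCurve, hα]
    rw [Point.some.injEq, hS, ← hl', hY, ← hx₃, ← hν, addY, negAddY, hXX3]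
    constructor
    · ring
    · rw [l₁]
      simp only [negY, twoTorsionCurve, zero_mul, sub_zero]
      linear_combination -l₃

/-- The 2-isogeny with kernel generated by `(0, 0)`. -/
def twoIsog [IsAlgClosed K] : (twoTorsionCurve α β).Point →+ (twoTorsionCurve α' β').Point where
  toFun := twoIsogFun h hα hβ
  map_zero' := rfl
  map_add' := twoIsogFun_add h hα hβ

lemma twoIsog_apply [IsAlgClosed K] (P : (twoTorsionCurve α β).Point) :
    twoIsog h hα hβ P = twoIsogFun h hα hβ P := rfl

include h hα hβ in
omit [DecidableEq K] in
lemma dualTwoIsog_nonsingular {x y : K} (hxy : (twoTorsionCurve α' β').Nonsingular x y)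
    (hx : x ≠ 0) :
    (twoTorsionCurve α β).Nonsingular (y ^ 2 / (4 * x ^ 2)) (y * (x ^ 2 - β') / (8 * x ^ 2)) := by
  rw [twoTorsionCurve_nonsingular (twoIsog_disc_ne_zero h hα hβ)] at hxy
  rw [twoTorsionCurve_nonsingular h, div_pow, mul_pow, hxy]
  subst hα hβ
  field_simp
  ring

/-- The isogeny dual to `twoIsog`, `(x, y) ↦ (y² / (4 x²), y (x² - β') / (8 x²))`. -/
def dualTwoIsogFun : (twoTorsionCurve α' β').Point → (twoTorsionCurve α β).Point
  | .zero => 0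
  | .some x _ hxy => if hx : x = 0 then 0 else .some _ _ (dualTwoIsog_nonsingular h hα hβ hxy hx)

lemma dualTwoIsogFun_some {x y : K} (hxy : (twoTorsionCurve α' β').Nonsingular x y) (hx : x ≠ 0) :
    dualTwoIsogFun h hα hβ (.some x y hxy) =
      .some _ _ (dualTwoIsog_nonsingular h hα hβ hxy hx) := by
  simp [dualTwoIsogFun, hx]

include h hα hβ in
/-- The dual isogeny is the 2-isogeny of the target curve followed by the scaling
`(x, y) ↦ (x / 4, y / 8)`. -/
lemma dualTwoIsogFun_eq_scaling [IsAlgClosed K] :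
    ∃ (h' : β' * (α' ^ 2 - 4 * β') ≠ 0) (hα' : 4 * α = -2 * α') (hβ'' : 16 * β = α' ^ 2 - 4 * β')
      (hns : ∀ x y, (twoTorsionCurve (4 * α) (16 * β)).Nonsingular x y →
        (twoTorsionCurve α β).Nonsingular (1 / 4 * x + 0) (1 / 8 * y + 0 * x + 0)),
      (∀ P Q, affineMap _ _ _ _ _ hns (P + Q) =
        affineMap _ _ _ _ _ hns P + affineMap _ _ _ _ _ hns Q) ∧
      Function.Surjective (affineMap _ _ _ _ _ hns) ∧
      ∀ P, dualTwoIsogFun h hα hβ P = affineMap _ _ _ _ _ hns (twoIsogFun h' hα' hβ'' P) := by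
  have h' := twoIsog_disc_ne_zero h hα hβ
  have hα' : 4 * α = -2 * α' := by rw [hα]; ring
  have hβ'' : 16 * β = α' ^ 2 - 4 * β' := by rw [hα, hβ]; ring
  have h'' := twoIsog_disc_ne_zero h' hα' hβ''
  have hns : ∀ x y, (twoTorsionCurve (4 * α) (16 * β)).Nonsingular x y ↔
      (twoTorsionCurve α β).Nonsingular (1 / 4 * x + 0) (1 / 8 * y + 0 * x + 0) := by
    intro x y
    rw [twoTorsionCurve_nonsingular h'', twoTorsionCurve_nonsingular h]
    constructor <;> intro hxy
    · linear_combination 1 / 64 * hxy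
    · linear_combination 64 * hxy
  refine ⟨h', hα', hβ'', fun x y => (hns x y).mp, fun P Q => ?_,
    affineMap_surjective _ _ _ _ _ (by norm_num) (by norm_num) _ fun x y => (hns x y).mpr, ?_⟩
  · have := twoTorsionCurve_infinite_point h''
    refine affineMap_add _ _ _ _ _ (by norm_num) (by norm_num) ?_ ?_ ?_ _ P Q
    all_goals simp [twoTorsionCurve]
    ring
  · rintro (_ | ⟨x, y, hxy⟩)
    · rfl
    · by_cases hx : x = 0
      · simp only [dualTwoIsogFun, twoIsogFun, hx]; rfl
      · rw [dualTwoIsogFun_some (hx := hx), twoIsogFun_some (hx := hx)]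
        simp only [affineMap, Point.some.injEq]
        constructor <;> (field_simp; try ring)

lemma dualTwoIsogFun_add [IsAlgClosed K] (P Q : (twoTorsionCurve α' β').Point) :
    dualTwoIsogFun h hα hβ (P + Q) = dualTwoIsogFun h hα hβ P + dualTwoIsogFun h hα hβ Q := by
  obtain ⟨h', hα', hβ'', hns, hadd, -, e⟩ := dualTwoIsogFun_eq_scaling h hα hβ
  rw [e, e, e, twoIsogFun_add, hadd]

/-- The dual of `twoIsog`. -/
def dualTwoIsog [IsAlgClosed K] : (twoTorsionCurve α' β').Point →+ (twoTorsionCurve α β).Point where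
  toFun := dualTwoIsogFun h hα hβ
  map_zero' := rfl
  map_add' := dualTwoIsogFun_add h hα hβ

lemma dualTwoIsog_apply [IsAlgClosed K] (P : (twoTorsionCurve α' β').Point) :
    dualTwoIsog h hα hβ P = dualTwoIsogFun h hα hβ P := rfl

lemma dualTwoIsog_twoIsog [IsAlgClosed K] (P : (twoTorsionCurve α β).Point) :
    dualTwoIsog h hα hβ (twoIsog h hα hβ P) = 2 • P := by
  rcases P with _ | ⟨x, y, hxy⟩
  · rw [← Point.zero_def, map_zero, map_zero, smul_zero]
  have e := (twoTorsionCurve_nonsingular h).mp hxy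
  rw [twoIsog_apply, dualTwoIsog_apply]
  have hneg : (twoTorsionCurve α β).negY x y = -y := by simp [negY, twoTorsionCurve]
  rw [two_smul]
  by_cases hy : y = 0
  · rw [Point.add_self_of_Y_eq (by rw [hneg, hy, neg_zero])]
    by_cases hx : x = 0
    · simp only [twoIsogFun, hx]; rfl
    · rw [twoIsogFun_some (hx := hx)]
      simp [dualTwoIsogFun, hy]
  · have hx : x ≠ 0 := by
      rintro rfl
      apply hy
      simpa using e
    have hy2 : y ≠ (twoTorsionCurve α β).negY x y := by
      rw [hneg]
      intro h'
      apply hy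
      linear_combination 1 / 2 * h'
    rw [Point.add_self_of_Y_ne hy2, twoIsogFun_some (hx := hx),
      dualTwoIsogFun_some (hx := div_ne_zero (pow_ne_zero 2 hy) (pow_ne_zero 2 hx)),
      Point.some.injEq, addY, negAddY, slope_of_Y_ne rfl hy2, hneg]
    have hX : (y * (x ^ 2 - β) / x ^ 2) ^ 2 / (4 * (y ^ 2 / x ^ 2) ^ 2) =
        (x ^ 2 - β) ^ 2 / (4 * y ^ 2) := by
      field_simp
    have hX' : (twoTorsionCurve α β).addX x x ((3 * x ^ 2 + 2 * (twoTorsionCurve α β).a₂ * x +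
        (twoTorsionCurve α β).a₄ - (twoTorsionCurve α β).a₁ * y) / (y - -y)) =
        (x ^ 2 - β) ^ 2 / (4 * y ^ 2) := by
      simp only [addX, twoTorsionCurve]
      field_simp
      linear_combination (-16 * α - 32 * x) * e
    rw [hX, hX']
    refine ⟨rfl, ?_⟩
    simp only [negY, twoTorsionCurve]
    rw [hβ]
    field_simp
    linear_combination (-32 * x ^ 3 * (3 * x ^ 2 + 2 * α * x + β) +
      (8 * (x ^ 2 - β) + 64 * x ^ 2) * (y ^ 2 + x ^ 3 + α * x ^ 2 + β * x)) * e

lemma twoIsog_surjective [IsAlgClosed K] : Function.Surjective (twoIsog h hα hβ) := by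
  rintro (_ | ⟨X, Y, hXY⟩)
  · exact ⟨0, rfl⟩
  have e := (twoTorsionCurve_nonsingular (twoIsog_disc_ne_zero h hα hβ)).mp hXY
  have hβ0 : β ≠ 0 := left_ne_zero_of_mul h
  obtain ⟨w, hw⟩ := IsAlgClosed.exists_pow_nat_eq X (n := 2) (by norm_num)
  -- the abscissa of a preimage is a root of `x² + (Y / w) x - β`, and of `x² + α x + β` if `w = 0`
  obtain ⟨x, hx0, hx, hYx⟩ : ∃ x : K, x ≠ 0 ∧ w ^ 2 * x = x ^ 2 + α * x + β ∧
      Y * x = w * (x ^ 2 - β) := by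
    by_cases hw0 : w = 0
    · have hX0 : X = 0 := by rw [← hw, hw0]; ring
      have hY0 : Y = 0 := by simpa [hX0] using e
      obtain ⟨d, hd⟩ := IsAlgClosed.exists_pow_nat_eq (α ^ 2 - 4 * β) (n := 2) (by norm_num)
      have hx : ((d - α) / 2) ^ 2 + α * ((d - α) / 2) + β = 0 := by linear_combination hd / 4
      refine ⟨(d - α) / 2, ?_, ?_, ?_⟩
      · intro h0
        rw [h0] at hx
        exact hβ0 (by simpa using hx)
      · rw [hx, hw0]; ring
      · rw [hw0, hY0]; ring
    · have hYw : (Y / w) ^ 2 = (w ^ 2 - α) ^ 2 - 4 * β := by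
        rw [div_pow, e, hw, hα, hβ]
        have : X ≠ 0 := by rw [← hw]; exact pow_ne_zero 2 hw0
        field_simp
        ring
      obtain ⟨v, hv⟩ : ∃ v, v = Y / w := ⟨_, rfl⟩
      have hY : Y = v * w := by rw [hv]; field_simp
      rw [← hv] at hYw
      refine ⟨(w ^ 2 - α + v) / 2, ?_, ?_, ?_⟩
      · intro h0
        apply hβ0
        linear_combination (w ^ 2 - α - v) / 2 * h0 + hYw / 4
      · linear_combination -hYw / 4
      · rw [hY]
        linear_combination w * hYw / 4
  refine ⟨.some x (w * x) ((twoTorsionCurve_nonsingular h).mpr (by linear_combination x * hx)), ?_⟩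
  rw [twoIsog_apply, twoIsogFun_some (hx := hx0), Point.some.injEq]
  constructor
  · field_simp
    exact hw
  · field_simp
    linear_combination -hYx

lemma dualTwoIsog_surjective [IsAlgClosed K] : Function.Surjective (dualTwoIsog h hα hβ) := by
  obtain ⟨h', hα', hβ'', hns, -, hsurj, e⟩ := dualTwoIsogFun_eq_scaling h hα hβ
  intro P
  obtain ⟨Q, rfl⟩ := hsurj P
  obtain ⟨R, rfl⟩ := twoIsog_surjective h' hα' hβ'' Q
  exact ⟨R, e R⟩

end TwoIsogeny

end WeierstrassCurve.Affine

/-! ### The 2-isogenies between a Tate curve and its intermediate curve -/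

section TateIsogeny

variable {c : ℚ} (hc : c ≠ 0) (hc' : 1 - 16 * c ≠ 0)

include hc hc' in
lemma tate_disc_ne_zero :
    (c : Qbar) ^ 2 * ((1 / 4 - 2 * (c : Qbar)) ^ 2 - 4 * (c : Qbar) ^ 2) ≠ 0 := by
  have e : (c : Qbar) ^ 2 * ((1 / 4 - 2 * (c : Qbar)) ^ 2 - 4 * (c : Qbar) ^ 2) =
    (c : Qbar) ^ 2 * ((1 - 16 * c : ℚ) : Qbar) / 16 := by push_cast; ring
  rw [e]
  have h1 : (c : Qbar) ≠ 0 := by exact_mod_cast hc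
  have h2 : ((1 - 16 * c : ℚ) : Qbar) ≠ 0 := by exact_mod_cast hc'
  exact div_ne_zero (mul_ne_zero (pow_ne_zero 2 h1) h2) (by norm_num)

lemma tate_alpha : (-1 / 2 + 4 * c : Qbar) = -2 * (1 / 4 - 2 * c) := by ring

lemma tate_beta :
    ((1 - 16 * c) / 16 : Qbar) = (1 / 4 - 2 * (c : Qbar)) ^ 2 - 4 * (c : Qbar) ^ 2 := by ring

include hc hc' in
lemma tate_infinite_point : Infinite ((tateCurve c)⁄Qbar).Point :=
  infinite_point _ fun x y hxy => (tateCurve_nonsingular hc hc').mpr <| by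
    simpa [equation_iff, tateCurve] using hxy

variable (c) in
/-- The intermediate curve `y² = x (x - 1/4) (x - 1/4 + 4 c)` of the Tate curve: its quotient by
the point `(-c, 0)` of order `2`. -/
abbrev midCurve : WeierstrassCurve.Affine Qbar :=
  twoTorsionCurve (-1 / 2 + 4 * c) ((1 - 16 * c) / 16)

include hc hc' in
lemma tateComplete_nonsingular {x y : Qbar} (hxy : ((tateCurve c)⁄Qbar).Nonsingular x y) :
    (twoTorsionCurve (1 / 4 - 2 * c : Qbar) (c ^ 2)).Nonsingular (1 * x + c)
      (1 * y + 1 / 2 * x + c / 2) := by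
  rw [tateCurve_nonsingular hc hc'] at hxy
  rw [twoTorsionCurve_nonsingular (tate_disc_ne_zero hc hc')]
  linear_combination hxy

/-- The change of variables `(x, y) ↦ (x + c, y + (x + c) / 2)` from the Tate curve to
`y² = x³ + (1/4 - 2 c) x² + c² x`. -/
def tateComplete :
    ((tateCurve c)⁄Qbar).Point →+ (twoTorsionCurve (1 / 4 - 2 * c : Qbar) (c ^ 2)).Point where
  toFun := affineMap 1 1 c (1 / 2) (c / 2) fun _ _ => tateComplete_nonsingular hc hc'
  map_zero' := rfl
  map_add' P Q := by
    have := tate_infinite_point hc hc'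
    refine affineMap_add _ _ _ _ _ one_ne_zero (by norm_num) ?_ ?_ ?_ _ P Q
    all_goals simp [twoTorsionCurve, tateCurve]
    all_goals ring

/-- The change of variables inverse to `tateComplete`. -/
def tateUncomplete :
    (twoTorsionCurve (1 / 4 - 2 * c : Qbar) (c ^ 2)).Point →+ ((tateCurve c)⁄Qbar).Point where
  toFun := affineMap 1 1 (-c) (-1 / 2) 0 fun x y hxy => by
    rw [twoTorsionCurve_nonsingular (tate_disc_ne_zero hc hc')] at hxy
    rw [tateCurve_nonsingular hc hc']
    linear_combination hxy
  map_zero' := rfl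
  map_add' P Q := by
    have := twoTorsionCurve_infinite_point (tate_disc_ne_zero hc hc')
    refine affineMap_add _ _ _ _ _ one_ne_zero (by norm_num) ?_ ?_ ?_ _ P Q
    all_goals simp [twoTorsionCurve, tateCurve]
    all_goals ring

lemma tateUncomplete_tateComplete (P : ((tateCurve c)⁄Qbar).Point) :
    tateUncomplete hc hc' (tateComplete hc hc' P) = P := by
  rcases P with _ | ⟨x, y, h⟩
  · rfl
  · change WeierstrassCurve.Affine.Point.some _ _ _ = _
    rw [Point.some.injEq]
    constructor <;> ring

/-- The quotient of the Tate curve by its point `(-c, 0)` of order `2`. -/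
def tateIsog : ((tateCurve c)⁄Qbar).Point →+ (midCurve c).Point :=
  (twoIsog (tate_disc_ne_zero hc hc') tate_alpha tate_beta).comp (tateComplete hc hc')

/-- The dual of `tateIsog`. -/
def tateIsogDual : (midCurve c).Point →+ ((tateCurve c)⁄Qbar).Point :=
  (tateUncomplete hc hc').comp (dualTwoIsog (tate_disc_ne_zero hc hc') tate_alpha tate_beta)

lemma tateComplete_surjective : Function.Surjective (tateComplete hc hc') := by
  rintro (_ | ⟨x, y, h⟩)
  · exact ⟨0, rfl⟩
  · refine ⟨tateUncomplete hc hc' (.some x y h), ?_⟩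
    change WeierstrassCurve.Affine.Point.some _ _ _ = _
    rw [Point.some.injEq]
    constructor <;> ring

lemma tateIsog_surjective : Function.Surjective (tateIsog hc hc') :=
  (twoIsog_surjective (tate_disc_ne_zero hc hc') tate_alpha tate_beta).comp
    (tateComplete_surjective hc hc')

lemma tateIsogDual_surjective : Function.Surjective (tateIsogDual hc hc') :=
  Function.Surjective.comp (g := tateUncomplete hc hc')
    (fun P => ⟨_, tateUncomplete_tateComplete hc hc' P⟩)
    (dualTwoIsog_surjective (tate_disc_ne_zero hc hc') tate_alpha tate_beta)

lemma tateIsogDual_tateIsog (P : ((tateCurve c)⁄Qbar).Point) :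
    tateIsogDual hc hc' (tateIsog hc hc' P) = 2 • P := by
  simp only [tateIsogDual, tateIsog, AddMonoidHom.comp_apply, dualTwoIsog_twoIsog, map_nsmul,
    tateUncomplete_tateComplete]

lemma tateIsog_tateIsogDual (P : (midCurve c).Point) :
    tateIsog hc hc' (tateIsogDual hc hc' P) = 2 • P := by
  obtain ⟨Q, rfl⟩ := tateIsog_surjective hc hc' P
  rw [tateIsogDual_tateIsog, map_nsmul]

lemma tateIsog_some {x y : Qbar} (h : ((tateCurve c)⁄Qbar).Nonsingular x y) (hx : x + c ≠ 0) :
    ∃ h', tateIsog hc hc' (.some x y h) =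
      .some ((y + (x + c) / 2) ^ 2 / (x + c) ^ 2)
        ((y + (x + c) / 2) * ((x + c) ^ 2 - c ^ 2) / (x + c) ^ 2) h' := by
  have e : tateIsog hc hc' (.some x y h) =
    twoIsogFun (tate_disc_ne_zero hc hc') tate_alpha tate_beta (tateComplete hc hc' (.some x y h)) := rfl
  have e2 : tateComplete hc hc' (.some x y h) = .some _ _ (tateComplete_nonsingular hc hc' h) := rfl
  rw [e, e2, twoIsogFun_some (hx := by rwa [one_mul])]
  exact exists_some_eq _ (by ring) (by ring)

lemma tateIsog_eq_zero {x y : Qbar} (h : ((tateCurve c)⁄Qbar).Nonsingular x y) (hx : x + c = 0) :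
    tateIsog hc hc' (.some x y h) = 0 := by
  change twoIsogFun (tate_disc_ne_zero hc hc') tate_alpha tate_beta
    (.some _ _ (tateComplete_nonsingular hc hc' h)) = 0
  simp [twoIsogFun, hx]

/-- The dual 2-isogeny in the coordinates `x = -c + ρ²`, `y = x² - k²`. -/
lemma tateIsogDual_some {x y ρ k : Qbar} (h : (midCurve c).Nonsingular x y) (hx : x ≠ 0)
    (hρ : 2 * x * ρ = y) (hk : 4 * x * k = x ^ 2 - (1 - 16 * c) / 16 - 2 * x * ρ) :
    ∃ h', tateIsogDual hc hc' (.some x y h) =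
      .some (-c + ρ ^ 2) ((-c + ρ ^ 2) ^ 2 - k ^ 2) h' := by
  have e : tateIsogDual hc hc' (.some x y h) = tateUncomplete hc hc'
    (dualTwoIsogFun (tate_disc_ne_zero hc hc') tate_alpha tate_beta (.some x y h)) := rfl
  have e' : y ^ 2 = x ^ 3 + (-1 / 2 + 4 * c) * x ^ 2 + (1 - 16 * c) / 16 * x :=
    (twoTorsionCurve_nonsingular (twoIsog_disc_ne_zero (tate_disc_ne_zero hc hc')
      tate_alpha tate_beta)).mp h
  rw [e, dualTwoIsogFun_some (hx := hx)]
  refine exists_some_eq (W := (tateCurve c)⁄Qbar) _ ?_ ?_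
  · rw [← hρ]; field_simp; ring
  · have hk' : k = (x ^ 2 - (1 - 16 * c) / 16 - 2 * x * ρ) / (4 * x) := by
      rw [← hk]; field_simp
    rw [← hρ] at e' ⊢
    have e2 : 4 * x * ρ ^ 2 = x ^ 2 + (-1 / 2 + 4 * c) * x + (1 - 16 * c) / 16 := by
      apply mul_left_cancel₀ hx
      linear_combination e'
    rw [hk']
    field_simp
    linear_combination (-2048 * x - 2048 * (4 * x * ρ ^ 2 + (x ^ 2 + (-1 / 2 + 4 * c) * x +
      (1 - 16 * c) / 16)) + 16384 * x * c) * e2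

lemma tateIsogDual_eq_zero {x y : Qbar} (h : (midCurve c).Nonsingular x y) (hx : x = 0) :
    tateIsogDual hc hc' (.some x y h) = 0 := by
  change tateUncomplete hc hc'
    (dualTwoIsogFun (tate_disc_ne_zero hc hc') tate_alpha tate_beta (.some x y h)) = 0
  simp [dualTwoIsogFun, hx]

end TateIsogeny

/-! ### The 4-isogenies -/

section FourIsogeny

variable (t : ℚˣ)

lemma t_ne_zero_Qbar : (t : Qbar) ≠ 0 := by exact_mod_cast t.ne_zero

lemma coefE_eq_Qbar : (coefE t : Qbar) = -1 / (4 * (t : Qbar) ^ 2) := by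
  have := t_ne_zero_Qbar t
  field_simp
  linear_combination four_sq_coefE t

lemma coefE'_eq_Qbar : (coefE' t : Qbar) = ((t : Qbar) ^ 2 + 4) / 64 := by
  linear_combination coefE'_eq t / 64

lemma mid_nonsingular {c : ℚ} (hc : c ≠ 0) (hc' : 1 - 16 * c ≠ 0) {x y : Qbar} :
    (midCurve c).Nonsingular x y ↔
      y ^ 2 = x ^ 3 + (-1 / 2 + 4 * c) * x ^ 2 + (1 - 16 * c) / 16 * x :=
  twoTorsionCurve_nonsingular (twoIsog_disc_ne_zero (tate_disc_ne_zero hc hc') tate_alpha tate_beta)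

lemma mid_infinite_point {c : ℚ} (hc : c ≠ 0) (hc' : 1 - 16 * c ≠ 0) :
    Infinite (midCurve c).Point :=
  twoTorsionCurve_infinite_point
    (twoIsog_disc_ne_zero (tate_disc_ne_zero hc hc') tate_alpha tate_beta)

lemma midIso_nonsingular {x y : Qbar} (h : (midCurve (coefE' t)).Nonsingular x y) :
    (midCurve (coefE t)).Nonsingular (4 / (t : Qbar) ^ 2 * x + 1 / 4)
      (8 / (t : Qbar) ^ 3 * y + 0 * x + 0) := by
  rw [mid_nonsingular (coefE'_ne t) (coefE'_ne' t), coefE'_eq_Qbar] at h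
  rw [mid_nonsingular (coefE_ne t) (coefE_ne' t), coefE_eq_Qbar]
  have := t_ne_zero_Qbar t
  have e : (8 / (t : Qbar) ^ 3 * y + 0 * x + 0) ^ 2 = 64 / (t : Qbar) ^ 6 * y ^ 2 := by ring
  rw [e, h]
  field_simp
  ring

lemma midIsoInv_nonsingular {x y : Qbar} (h : (midCurve (coefE t)).Nonsingular x y) :
    (midCurve (coefE' t)).Nonsingular ((t : Qbar) ^ 2 / 4 * x + -(t : Qbar) ^ 2 / 16)
      ((t : Qbar) ^ 3 / 8 * y + 0 * x + 0) := by
  rw [mid_nonsingular (coefE_ne t) (coefE_ne' t), coefE_eq_Qbar] at h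
  rw [mid_nonsingular (coefE'_ne t) (coefE'_ne' t), coefE'_eq_Qbar]
  have := t_ne_zero_Qbar t
  have e : ((t : Qbar) ^ 3 / 8 * y + 0 * x + 0) ^ 2 = (t : Qbar) ^ 6 / 64 * y ^ 2 := by ring
  rw [e, h]
  field_simp
  ring

/-- The intermediate curves of `E'` and of `E` are isomorphic: this is what makes `E'` and `E`
4-isogenous. The isomorphism sends `(0, 0)` to `(1/4, 0)`, so the composite 4-isogeny is cyclic. -/
def midIso : (midCurve (coefE' t)).Point →+ (midCurve (coefE t)).Point where
  toFun := affineMap _ _ _ _ _ fun _ _ => midIso_nonsingular t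
  map_zero' := rfl
  map_add' P Q := by
    have := mid_infinite_point (coefE'_ne t) (coefE'_ne' t)
    have ht := t_ne_zero_Qbar t
    refine affineMap_add _ _ _ _ _ (by simp) ?_ ?_ ?_ ?_ _ P Q
    · field_simp; norm_num
    · simp [twoTorsionCurve]
    · simp [twoTorsionCurve]
    · simp only [twoTorsionCurve, coefE_eq_Qbar, coefE'_eq_Qbar]
      field_simp
      ring

/-- The inverse of `midIso`. -/
def midIsoInv : (midCurve (coefE t)).Point →+ (midCurve (coefE' t)).Point where
  toFun := affineMap _ _ _ _ _ fun _ _ => midIsoInv_nonsingular t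
  map_zero' := rfl
  map_add' P Q := by
    have := mid_infinite_point (coefE_ne t) (coefE_ne' t)
    have ht := t_ne_zero_Qbar t
    refine affineMap_add _ _ _ _ _ (by simp) ?_ ?_ ?_ ?_ _ P Q
    · field_simp; norm_num
    · simp [twoTorsionCurve]
    · simp [twoTorsionCurve]
    · simp only [twoTorsionCurve, coefE_eq_Qbar, coefE'_eq_Qbar]
      field_simp
      ring

lemma midIso_midIsoInv (P : (midCurve (coefE t)).Point) : midIso t (midIsoInv t P) = P := by
  have ht := t_ne_zero_Qbar t
  rcases P with _ | ⟨x, y, h⟩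
  · rfl
  · change WeierstrassCurve.Affine.Point.some _ _ _ = _
    rw [Point.some.injEq]
    constructor
    · field_simp; ring
    · field_simp; ring

lemma midIsoInv_midIso (P : (midCurve (coefE' t)).Point) : midIsoInv t (midIso t P) = P := by
  have ht := t_ne_zero_Qbar t
  rcases P with _ | ⟨x, y, h⟩
  · rfl
  · change WeierstrassCurve.Affine.Point.some _ _ _ = _
    rw [Point.some.injEq]
    constructor
    · field_simp; ring
    · field_simp; ring

lemma exists_dualFun_some {X Y : Qbar} (h : ((curveE' t)⁄Qbar).Nonsingular X Y)
    (h0 : (X + coefE' t) * (X + 2 * coefE' t) ≠ 0) :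
    ∃ h', dualFun t (.some X Y h) = .some (dualX t X Y) (dualY t X Y) h' :=
  ⟨dual_nonsingular t h h0, by simp only [dualFun, h0, dite_false]⟩

lemma exists_phiFun_some {x y : Qbar} (h : ((curveE t)⁄Qbar).Nonsingular x y)
    (h0 : x * (x + coefE t) ≠ 0) :
    ∃ h', phiFun t (.some x y h) = .some (phiX t x y) (phiY t x y) h' :=
  ⟨phi_nonsingular t h h0, by simp only [phiFun, h0, dite_false]⟩

/-- The quotient of `E` by `2 T₀`. -/
def isogE : PtE t →+ (midCurve (coefE t)).Point := tateIsog (coefE_ne t) (coefE_ne' t)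

/-- The dual of `isogE`. -/
def isogEDual : (midCurve (coefE t)).Point →+ PtE t := tateIsogDual (coefE_ne t) (coefE_ne' t)

/-- The quotient of `E'` by its point `(-A, 0)` of order `2`. -/
def isogE' : PtE' t →+ (midCurve (coefE' t)).Point := tateIsog (coefE'_ne t) (coefE'_ne' t)

/-- The dual of `isogE'`. -/
def isogE'Dual : (midCurve (coefE' t)).Point →+ PtE' t := tateIsogDual (coefE'_ne t) (coefE'_ne' t)

/-- The explicit map `φ̂` is a 2-isogeny, an isomorphism and the dual of a 2-isogeny. -/
lemma dualFun_eq (P : PtE' t) : dualFun t P = isogEDual t (midIso t (isogE' t P)) := by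
  have ht := t_ne_zero_Qbar t
  rcases P with _ | ⟨X, Y, h⟩
  · rfl
  have e := (curveE'_nonsingular t).mp h
  by_cases hX : X + (coefE' t : Qbar) = 0
  · have e₁ : isogE' t (.some X Y h) = 0 := tateIsog_eq_zero _ _ h hX
    rw [e₁, map_zero, map_zero]
    simp [dualFun, hX]
  obtain ⟨h₁, e₁⟩ := tateIsog_some (coefE'_ne t) (coefE'_ne' t) h hX
  have hA := coefE'_eq t
  have ha := coefE_eq_Qbar t
  obtain ⟨U, hU⟩ : ∃ U, U = X + (coefE' t : Qbar) := ⟨_, rfl⟩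
  obtain ⟨w, hw⟩ : ∃ w, w = Y + U / 2 := ⟨_, rfl⟩
  have ew : w ^ 2 = U ^ 3 + (1 / 4 - 2 * coefE' t) * U ^ 2 + coefE' t ^ 2 * U := by
    rw [hw, hU]; linear_combination e
  have hX' : X + 2 * (coefE' t : Qbar) = U + coefE' t := by rw [hU]; ring
  have hX0 : X = U - (coefE' t : Qbar) := by rw [hU]; ring
  have hw2 : 2 * Y + X + (coefE' t : Qbar) = 2 * w := by rw [hw, hU]; ring
  have hU0 : U ≠ 0 := by rwa [hU]
  have key : 4 / (t : Qbar) ^ 2 * (w ^ 2 / U ^ 2) + 1 / 4 =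
      4 * (U + coefE' t) ^ 2 / ((t : Qbar) ^ 2 * U) := by
    rw [ew]
    field_simp
    linear_combination -U * hA
  have e₂ : midIso t (isogE' t (.some X Y h)) = .some _ _ (midIso_nonsingular t h₁) := by
    have e₁' : isogE' t (.some X Y h) = _ := e₁
    rw [e₁']; rfl
  rw [e₂]
  by_cases hX2 : X + 2 * (coefE' t : Qbar) = 0
  · refine Eq.trans ?_ (tateIsogDual_eq_zero (coefE_ne t) (coefE_ne' t) _ ?_).symm
    · simp [dualFun, hX2]; rfl
    · rw [← hU, ← hw, key, ← hX', hX2]; simp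
  have hUA : U + (coefE' t : Qbar) ≠ 0 := by rwa [← hX']
  obtain ⟨h₃, e₃⟩ := exists_dualFun_some t h (mul_ne_zero hX hX2)
  have hr : X * (2 * Y + X + coefE' t) / (2 * (t : Qbar) * (X + coefE' t) * (X + 2 * coefE' t)) =
      w * (U - coefE' t) / (t * U * (U + coefE' t)) := by
    rw [hw2, hX', ← hU, hX0]; field_simp
  have hg : (2 * (X + 2 * coefE' t) * (2 * Y + X + coefE' t) - (t : Qbar) * X * (X + coefE' t)) /
      (4 * (t : Qbar) * (X + coefE' t) * (X + 2 * coefE' t)) =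
      w / (t * U) - (U - coefE' t) / (4 * (U + coefE' t)) := by
    rw [hw2, hX', ← hU, hX0]; field_simp; ring
  obtain ⟨h₄, e₄⟩ := tateIsogDual_some (coefE_ne t) (coefE_ne' t) (midIso_nonsingular t h₁)
    (ρ := w * (U - coefE' t) / (t * U * (U + coefE' t)))
    (k := (w / (t * U) - (U - coefE' t) / (4 * (U + coefE' t))) ^ 2)
    (by
      rw [← hU, ← hw, key]
      exact div_ne_zero (mul_ne_zero (by norm_num) (pow_ne_zero 2 hUA))
        (mul_ne_zero (pow_ne_zero 2 ht) hU0))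
    (by
      rw [← hU, ← hw, key]
      field_simp
      ring)
    (by
      rw [← hU, ← hw, key, ha]
      have e5 : (w / (t * U) - (U - coefE' t) / (4 * (U + coefE' t) : Qbar)) ^ 2 =
          w ^ 2 / (t * U) ^ 2 + ((U - coefE' t) / (4 * (U + coefE' t))) ^ 2
           - w * (U - coefE' t) / (t * U * (U + coefE' t)) / 2 := by
        field_simp
        ring
      rw [e5, ew]
      have ht2 : (t : Qbar) ^ 2 = 64 * coefE' t - 4 := by rw [hA]; ring
      field_simp
      linear_combination (8 * U ^ 2 * ((t : Qbar) ^ 2 + 64 * coefE' t - 4) +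
        128 * U * (U - coefE' t) ^ 2 + 32 * U ^ 2) * ht2)
  rw [e₃]
  refine Eq.trans (some_congr (W := (curveE t)⁄Qbar) ?_ ?_) e₄.symm
  · rw [dualX, hr]
  · rw [dualY, dualX, hr, hg]; ring

/-- The explicit map `φ` is a 2-isogeny, an isomorphism and the dual of a 2-isogeny. -/
lemma phiFun_eq (P : PtE t) : phiFun t P = isogE'Dual t (midIsoInv t (isogE t P)) := by
  have ht := t_ne_zero_Qbar t
  rcases P with _ | ⟨x, y, h⟩
  · rfl
  have e := (curveE_nonsingular t).mp h
  by_cases hx : x + (coefE t : Qbar) = 0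
  · have e₁ : isogE t (.some x y h) = 0 := tateIsog_eq_zero _ _ h hx
    rw [e₁, map_zero, map_zero]
    simp [phiFun, hx]
  obtain ⟨h₁, e₁⟩ := tateIsog_some (coefE_ne t) (coefE_ne' t) h hx
  have hA := coefE'_eq_Qbar t
  have ha := coefE_eq_Qbar t
  obtain ⟨u, hu⟩ : ∃ u, u = x + (coefE t : Qbar) := ⟨_, rfl⟩
  obtain ⟨v, hv⟩ : ∃ v, v = y + u / 2 := ⟨_, rfl⟩
  have ev : v ^ 2 = u ^ 3 + (1 / 4 - 2 * coefE t) * u ^ 2 + coefE t ^ 2 * u := by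
    rw [hv, hu]; linear_combination e
  have hx' : x + 2 * (coefE t : Qbar) = u + coefE t := by rw [hu]; ring
  have hx0 : x = u - (coefE t : Qbar) := by rw [hu]; ring
  have hv2 : 2 * y + x + (coefE t : Qbar) = 2 * v := by rw [hv, hu]; ring
  have hu0 : u ≠ 0 := by rwa [hu]
  have key : (t : Qbar) ^ 2 / 4 * (v ^ 2 / u ^ 2) + -(t : Qbar) ^ 2 / 16 =
      (t : Qbar) ^ 2 * x ^ 2 / (4 * u) := by
    rw [ev, hx0]
    field_simp
    ring
  have e₂ : midIsoInv t (isogE t (.some x y h)) = .some _ _ (midIsoInv_nonsingular t h₁) := by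
    have e₁' : isogE t (.some x y h) = _ := e₁
    rw [e₁']; rfl
  rw [e₂]
  by_cases hx2 : x = 0
  · refine Eq.trans ?_ (tateIsogDual_eq_zero (coefE'_ne t) (coefE'_ne' t) _ ?_).symm
    · simp [phiFun, hx2]; rfl
    · rw [← hu, ← hv, key, hx2]; simp
  obtain ⟨h₃, e₃⟩ := exists_phiFun_some t h (mul_ne_zero hx2 hx)
  have hr : (t : Qbar) * (x + 2 * coefE t) * (2 * y + x + coefE t) / (8 * x * (x + coefE t)) =
      t * v * (u + coefE t) / (4 * u * x) := by
    rw [hv2, hx', ← hu]; field_simp; ring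
  have hg : (x + coefE t : Qbar) ^ 2 *
      (((2 * y + x + coefE t) - 2 * (t : Qbar) * x * (x + 2 * coefE t)) /
        (8 * x * (x + coefE t))) ^ 4 =
      ((v - t * x * (u + coefE t)) ^ 2 / (16 * x ^ 2 * u)) ^ 2 := by
    rw [hv2, hx', ← hu]; field_simp; ring
  obtain ⟨h₄, e₄⟩ := tateIsogDual_some (coefE'_ne t) (coefE'_ne' t) (midIsoInv_nonsingular t h₁)
    (ρ := t * v * (u + coefE t) / (4 * u * x))
    (k := (v - t * x * (u + coefE t)) ^ 2 / (16 * x ^ 2 * u))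
    (by
      rw [← hu, ← hv, key]
      exact div_ne_zero (mul_ne_zero (pow_ne_zero 2 ht) (pow_ne_zero 2 hx2))
        (mul_ne_zero (by norm_num) hu0))
    (by
      rw [← hu, ← hv, key]
      field_simp
      rw [hx0]
      ring)
    (by
      rw [← hu, ← hv, key, hA]
      have e5 : (v - t * x * (u + coefE t : Qbar)) ^ 2 =
          v ^ 2 + t ^ 2 * x ^ 2 * (u + coefE t) ^ 2 - 2 * v * t * x * (u + coefE t) := by
        ring
      rw [e5, ev]
      rw [ha] at hx0 ⊢
      have hxt : 4 * (t : Qbar) ^ 2 * x = 4 * t ^ 2 * u + 1 := by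
        rw [hx0]; field_simp; ring
      field_simp
      apply mul_left_cancel₀ (pow_ne_zero 2 ht)
      linear_combination
        (4 * t ^ 2 * x + 4 * t ^ 2 * u + 1) * (16 * (4 * u * t ^ 2 - 1) ^ 2 -
          16 * ((4 * t ^ 2 * x) ^ 2 + (4 * t ^ 2 * u + 1) ^ 2)) * hxt)
  rw [e₃]
  refine Eq.trans (some_congr (W := (curveE' t)⁄Qbar) ?_ ?_) e₄.symm
  · rw [phiX, hr]
  · rw [phiY, phiX, hr, hg]

lemma isogE_isogEDual (P : (midCurve (coefE t)).Point) : isogE t (isogEDual t P) = 2 • P :=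
  tateIsog_tateIsogDual _ _ P

lemma isogEDual_isogE (P : PtE t) : isogEDual t (isogE t P) = 2 • P :=
  tateIsogDual_tateIsog _ _ P

lemma isogE'_isogE'Dual (P : (midCurve (coefE' t)).Point) : isogE' t (isogE'Dual t P) = 2 • P :=
  tateIsog_tateIsogDual _ _ P

lemma isogE'Dual_isogE' (P : PtE' t) : isogE'Dual t (isogE' t P) = 2 • P :=
  tateIsogDual_tateIsog _ _ P

lemma dualFun_surjective : Function.Surjective (dualFun t) := by
  rw [funext (dualFun_eq t)]
  exact Function.Surjective.comp (g := isogEDual t) (tateIsogDual_surjective _ _)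
    (Function.Surjective.comp (g := midIso t) (fun P => ⟨_, midIso_midIsoInv t P⟩)
      (tateIsog_surjective _ _))

lemma phiFun_surjective : Function.Surjective (phiFun t) := by
  rw [funext (phiFun_eq t)]
  exact Function.Surjective.comp (g := isogE'Dual t) (tateIsogDual_surjective _ _)
    (Function.Surjective.comp (g := midIsoInv t) (fun P => ⟨_, midIsoInv_midIso t P⟩)
      (tateIsog_surjective _ _))

lemma dualFun_phiFun (P : PtE t) : dualFun t (phiFun t P) = 4 • P := by
  rw [dualFun_eq, phiFun_eq, isogE'_isogE'Dual, map_nsmul, midIso_midIsoInv, map_nsmul,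
    isogEDual_isogE, smul_smul]
  norm_num

lemma phiFun_dualFun (P : PtE' t) : phiFun t (dualFun t P) = 4 • P := by
  rw [dualFun_eq, phiFun_eq, isogE_isogEDual, map_nsmul, midIsoInv_midIso, map_nsmul,
    isogE'Dual_isogE', smul_smul]
  norm_num

lemma smul_some {W : WeierstrassCurve ℚ} (σ : GQ) {x y : Qbar} (h : (W⁄Qbar).Nonsingular x y) :
    ∃ h', σ • (Point.some x y h : (W⁄Qbar).Point) = .some (σ x) (σ y) h' :=
  ⟨_, rfl⟩

lemma gal_ratCast (σ : GQ) (q : ℚ) : σ (q : Qbar) = q := map_ratCast σ q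

/-- The isogeny `φ` as a homomorphism of Galois modules. -/
def phiHom : PtE t →+[GQ] PtE' t where
  toFun := phiFun t
  map_smul' σ P := by
    rcases P with _ | ⟨x, y, h⟩
    · rfl
    obtain ⟨h', e'⟩ := smul_some σ h
    have hσ : σ x * (σ x + coefE t) = σ (x * (x + coefE t)) := by
      simp only [map_mul, map_add, gal_ratCast]
    rw [e']
    by_cases h0 : x * (x + coefE t) = 0
    · rw [h0, map_zero] at hσ
      simp only [phiFun, h0, hσ, dite_true]
      exact (smul_zero σ).symm
    · obtain ⟨h₁, e₁⟩ := exists_phiFun_some t h h0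
      obtain ⟨h₂, e₂⟩ := exists_phiFun_some t h' (by rw [hσ]; exact (map_ne_zero σ).mpr h0)
      obtain ⟨h₃, e₃⟩ := smul_some σ h₁
      rw [e₁, e₂]
      refine Eq.trans (some_congr ?_ ?_) e₃.symm
      all_goals simp only [phiX, phiY, map_mul, map_add, map_div₀, map_pow, map_neg, map_sub,
        gal_ratCast, map_ofNat]
  map_zero' := rfl
  map_add' P Q := by simp only [phiFun_eq, map_add]

/-- The isogeny `φ̂` as a homomorphism of Galois modules. -/
def dualHom : PtE' t →+[GQ] PtE t where
  toFun := dualFun t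
  map_smul' σ P := by
    rcases P with _ | ⟨x, y, h⟩
    · rfl
    obtain ⟨h', e'⟩ := smul_some σ h
    have hσ : (σ x + coefE' t) * (σ x + 2 * coefE' t) =
        σ ((x + coefE' t) * (x + 2 * coefE' t)) := by
      simp only [map_mul, map_add, gal_ratCast, map_ofNat]
    rw [e']
    by_cases h0 : (x + coefE' t) * (x + 2 * coefE' t) = 0
    · rw [h0, map_zero] at hσ
      simp only [dualFun, h0, hσ, dite_true]
      exact (smul_zero σ).symm
    · obtain ⟨h₁, e₁⟩ := exists_dualFun_some t h h0
      obtain ⟨h₂, e₂⟩ := exists_dualFun_some t h' (by rw [hσ]; exact (map_ne_zero σ).mpr h0)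
      obtain ⟨h₃, e₃⟩ := smul_some σ h₁
      rw [e₁, e₂]
      refine Eq.trans (some_congr ?_ ?_) e₃.symm
      all_goals simp only [dualX, dualY, map_mul, map_add, map_div₀, map_pow, map_neg, map_sub,
        gal_ratCast, map_ofNat]
  map_zero' := rfl
  map_add' P Q := by simp only [dualFun_eq, map_add]

end FourIsogeny

/-! ### The function `g` on `E'` with `(x² - y) ∘ φ̂ = g⁴` -/

section Translation

/-- Translation by a point of order `4` in the kernel of `φ̂` multiplies `g` by a square root of
`-1`: on the curve `w² = U³ + (1/4 - 2 A) U² + A² U` it interchanges `w / U` and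
`(U - A) / (U + A)` up to constants. -/
lemma translation_identity {K : Type*} [Field K] [CharZero K] {A U w t i L U₂ w₂ : K}
    (hA : A = (t ^ 2 + 4) / 64) (hi : i ^ 2 = -1)
    (ew : w ^ 2 = U ^ 3 + (1 / 4 - 2 * A) * U ^ 2 + A ^ 2 * U) (ht : t ≠ 0) (hU : U ≠ 0)
    (hUA : U + A ≠ 0) (hL : L = (w - i * A * t / 4) / (U + A))
    (hU₂ : U₂ = L ^ 2 - 1 / 4 + 3 * A - U) (hw₂ : w₂ = -(L * (U₂ - U) + w))
    (h₂ : U₂ ≠ 0) (h₂' : U₂ + A ≠ 0) :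
    w₂ / (t * U₂) - (U₂ - A) / (4 * (U₂ + A)) =
      i * (w / (t * U) - (U - A) / (4 * (U + A))) := by
  have hLm : L * (U + A) = w - i * A * t / 4 := by rw [hL]; field_simp
  -- the abscissa of the translate
  have hN : U₂ * (U + A) ^ 2 = -A * (U ^ 2 - (6 * A - 1 / 2) * U + A ^ 2 + i * t / 2 * w) := by
    have e : U₂ * (U + A) ^ 2 =
        (L * (U + A)) ^ 2 - (1 / 4 - 3 * A + U) * (U + A) ^ 2 := by rw [hU₂]; ring
    rw [e, hLm]
    subst hA
    linear_combination ew + ((t ^ 2 + 4) / 64) ^ 2 * t ^ 2 / 16 * hi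
  have hZ : (U₂ - A) * U * t = -4 * i * w * (U₂ + A) := by
    apply mul_left_cancel₀ (pow_ne_zero 2 hUA)
    have e : (U + A) ^ 2 * ((U₂ - A) * U * t) - (U + A) ^ 2 * (-4 * i * w * (U₂ + A)) =
      (U₂ * (U + A) ^ 2 - A * (U + A) ^ 2) * U * t +
        4 * i * w * (U₂ * (U + A) ^ 2 + A * (U + A) ^ 2) := by ring
    rw [← sub_eq_zero, e, hN]
    subst hA
    linear_combination (2 * ((t ^ 2 + 4) / 64) * t) * ew
      - 2 * ((t ^ 2 + 4) / 64) * t * w ^ 2 * hi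
  have hW : w₂ * (U + A) = -(i * t / 4) * U₂ * (U - A) := by
    apply mul_left_cancel₀ (pow_ne_zero 2 hUA)
    have e : (U + A) ^ 2 * (w₂ * (U + A)) - (U + A) ^ 2 * (-(i * t / 4) * U₂ * (U - A)) =
        -((L * (U + A)) * (U₂ * (U + A) ^ 2 - U * (U + A) ^ 2) + w * (U + A) ^ 3) +
          i * t / 4 * (U₂ * (U + A) ^ 2) * (U - A) := by rw [hw₂]; ring
    rw [← sub_eq_zero, e, hN, hLm]
    subst hA
    linear_combination ((t ^ 2 + 4) / 64) * i * t / 2 * ew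
      - ((t ^ 2 + 4) / 64) * t ^ 2 * w * U / 8 * hi
  have e1 : w₂ / (t * U₂) = -(i / 4) * ((U - A) / (U + A)) := by
    field_simp
    linear_combination 4 * hW
  have e2 : (U₂ - A) / (4 * (U₂ + A)) = -i * (w / (t * U)) := by
    field_simp
    linear_combination hZ
  rw [e1, e2]
  field_simp
  ring

variable (t : ℚˣ)

/-- The function `g` on `E'` with `(x² - y) ∘ φ̂ = g⁴`, given the value `0` at the origin. -/
def dualRoot : PtE' t → Qbar
  | .zero => 0
  | .some X Y _ => (2 * (X + 2 * coefE' t) * (2 * Y + X + coefE' t) -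
      (t : Qbar) * X * (X + coefE' t)) / (4 * (t : Qbar) * (X + coefE' t) * (X + 2 * coefE' t))

lemma dualRoot_some {X Y : Qbar} (h : ((curveE' t)⁄Qbar).Nonsingular X Y)
    (h1 : X + (coefE' t : Qbar) ≠ 0) (h2 : X + 2 * (coefE' t : Qbar) ≠ 0) :
    dualRoot t (.some X Y h) = (Y + (X + coefE' t) / 2) / (t * (X + coefE' t)) -
      ((X + coefE' t) - coefE' t) / (4 * ((X + coefE' t) + coefE' t)) := by
  have ht := t_ne_zero_Qbar t
  have h3 : X + coefE' t + coefE' t = X + 2 * (coefE' t : Qbar) := by ring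
  rw [dualRoot, h3]
  field_simp
  ring

lemma dualRoot_smul (σ : GQ) (P : PtE' t) : dualRoot t (σ • P) = σ (dualRoot t P) := by
  rcases P with _ | ⟨X, Y, h⟩
  · exact (map_zero σ).symm
  · obtain ⟨h', e⟩ := smul_some σ h
    rw [e]
    simp only [dualRoot, map_mul, map_add, map_div₀, map_sub, gal_ratCast, map_ofNat]

lemma dualFun_some_ne_zero {X Y : Qbar} (h : ((curveE' t)⁄Qbar).Nonsingular X Y)
    (h0 : dualFun t (.some X Y h) ≠ 0) :
    X + (coefE' t : Qbar) ≠ 0 ∧ X + 2 * (coefE' t : Qbar) ≠ 0 := by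
  rw [← mul_ne_zero_iff]
  intro h1
  simp [dualFun, h1] at h0

lemma dualRoot_pow_four {P' : PtE' t} {x y : Qbar} (h : ((curveE t)⁄Qbar).Nonsingular x y)
    (hP : dualFun t P' = .some x y h) : dualRoot t P' ^ 4 = x ^ 2 - y := by
  rcases P' with _ | ⟨X, Y, h'⟩
  · exact absurd hP.symm (Point.some_ne_zero h)
  · have h0 := dualFun_some_ne_zero t h' (by rw [hP]; exact Point.some_ne_zero h)
    obtain ⟨h₁, e⟩ := exists_dualFun_some t h' (mul_ne_zero h0.1 h0.2)
    rw [e] at hP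
    obtain ⟨hx, hy⟩ := Point.some.inj hP
    rw [← hx, ← hy, dualY, dualRoot]
    ring

lemma dualFun_dualTorsionPt (i : Qbar) (hi : i ^ 2 = -1) :
    dualFun t (dualTorsionPt t i hi) = 0 := by
  simp [dualFun, dualTorsionPt]

lemma dualRoot_add_dualTorsionPt (i : Qbar) (hi : i ^ 2 = -1) (P : PtE' t) (hP : dualFun t P ≠ 0) :
    dualRoot t (P + dualTorsionPt t i hi) = i * dualRoot t P := by
  have hadd : dualFun t (P + dualTorsionPt t i hi) = dualFun t P := by
    have h : dualFun t (P + dualTorsionPt t i hi) =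
        dualFun t P + dualFun t (dualTorsionPt t i hi) :=
      map_add (dualHom t) P (dualTorsionPt t i hi)
    rw [h, dualFun_dualTorsionPt, add_zero]
  rw [← hadd] at hP
  rcases P with _ | ⟨X, Y, h⟩
  · exact absurd (by rw [hadd]; rfl) hP
  have hP' := hP
  rw [hadd] at hP'
  obtain ⟨h1, h2⟩ := dualFun_some_ne_zero t h hP'
  have hX : X ≠ -2 * (coefE' t : Qbar) := by
    intro h3; apply h2; rw [h3]; ring
  have e := (curveE'_nonsingular t).mp h
  have h4 : X + 2 * (coefE' t : Qbar) = X + coefE' t + coefE' t := by ring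
  obtain ⟨hq, eq⟩ : ∃ h, dualTorsionPt t i hi = .some (-2 * (coefE' t : Qbar))
    ((coefE' t : Qbar) * ((2 + i * (t : Qbar)) / 4)) h := ⟨_, rfl⟩
  rw [eq, Point.add_of_X_ne hX] at hP ⊢
  obtain ⟨h1', h2'⟩ := dualFun_some_ne_zero t _ hP
  rw [dualRoot_some t _ h1' h2', dualRoot_some t h h1 h2]
  rw [show ∀ z : Qbar, z + 2 * (coefE' t : Qbar) = z + coefE' t + coefE' t by intro z; ring] at h2'
  have hD : X - -2 * (coefE' t : Qbar) = X + coefE' t + coefE' t := by ring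
  have hD0 : X + (coefE' t : Qbar) + coefE' t ≠ 0 := by rwa [← h4]
  -- the slope in the coordinates `U = X + A`, `w = Y + U / 2`
  have hsl : ((curveE' t)⁄Qbar).slope X (-2 * (coefE' t : Qbar)) Y
      ((coefE' t : Qbar) * ((2 + i * (t : Qbar)) / 4)) =
      (Y + (X + coefE' t) / 2 - i * coefE' t * t / 4) / (X + coefE' t + coefE' t) - 1 / 2 := by
    rw [slope_of_X_ne hX, hD]
    field_simp
    ring
  have hX₂ : ∀ l, ((curveE' t)⁄Qbar).addX X (-2 * (coefE' t : Qbar)) l =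
      l ^ 2 + l + coefE' t - X := by
    intro l
    simp [addX, curveE', tateCurve]
    ring
  have hY₂ : ∀ l, ((curveE' t)⁄Qbar).addY X (-2 * (coefE' t : Qbar)) Y l =
      -(l * (((curveE' t)⁄Qbar).addX X (-2 * (coefE' t : Qbar)) l - X) + Y) -
        ((curveE' t)⁄Qbar).addX X (-2 * (coefE' t : Qbar)) l - coefE' t := by
    intro l
    simp [addY, negAddY, negY, curveE', tateCurve]
  refine translation_identity (coefE'_eq_Qbar t) hi ?_ (t_ne_zero_Qbar t) h1 (by rwa [← h4]) rfl
    ?_ ?_ h1' h2'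
  · linear_combination e
  · rw [hX₂, hsl]; ring
  · rw [hY₂, hX₂, hsl]; ring

end Translation

/-! ### The kernels of `φ` and `φ̂` -/

section Kernels

variable (t : ℚˣ)

lemma neg_some_eq {W : WeierstrassCurve.Affine Qbar} {x y x' y' : Qbar} {h : W.Nonsingular x y}
    {h' : W.Nonsingular x' y'} (hx : x = x') (hy : y = W.negY x' y') :
    (Point.some x y h) = -(Point.some x' y' h') := by
  rw [Point.neg_some]
  exact some_congr hx hy

/-- The point `(-a, 0)` of order `2` on `E`. -/
def twoTorsionE : PtE t :=
  .some (-(coefE t : Qbar)) 0 ((curveE_nonsingular t).mpr (by ring))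

/-- The point `(-A, 0)` of order `2` on `E'`. -/
def twoTorsionE' : PtE' t :=
  .some (-(coefE' t : Qbar)) 0 ((curveE'_nonsingular t).mpr (by ring))

lemma two_smul_originPt : (2 : ℕ) • originPt t = twoTorsionE t := by
  have ha : (coefE t : Qbar) ≠ 0 := by exact_mod_cast coefE_ne t
  have hn : (0 : Qbar) ≠ ((curveE t)⁄Qbar).negY 0 0 := by
    simpa [negY, curveE, tateCurve] using ha
  rw [two_smul]
  refine (Point.add_self_of_Y_ne hn).trans (some_congr ?_ ?_)
  · rw [slope_of_Y_ne rfl hn]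
    simp [addX, curveE, tateCurve]
  · rw [slope_of_Y_ne rfl hn]
    simp [addX, addY, negAddY, negY, curveE, tateCurve]

lemma four_smul_originPt : (4 : ℕ) • originPt t = 0 := by
  have e : (4 : ℕ) • originPt t = (2 : ℕ) • (2 : ℕ) • originPt t := by
    rw [smul_smul]
    norm_num
  rw [e, two_smul_originPt, two_smul]
  exact Point.add_self_of_Y_eq (by simp [negY, curveE, tateCurve])

lemma phiFun_originPt : phiFun t (originPt t) = 0 := by simp [phiFun, originPt]

lemma exists_eq_smul_originPt (P : PtE t) (hP : phiFun t P = 0) : ∃ m : ℤ, P = m • originPt t := by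
  rcases P with _ | ⟨x, y, h⟩
  · exact ⟨0, (zero_zsmul _).symm⟩
  have e := (curveE_nonsingular t).mp h
  by_cases h0 : x * (x + coefE t) = 0
  · rcases mul_eq_zero.mp h0 with hx | hx
    · have hy : y * (y + coefE t) = 0 := by rw [hx] at e; linear_combination e
      rcases mul_eq_zero.mp hy with hy | hy
      · refine ⟨1, ?_⟩
        rw [one_smul]
        exact some_congr hx hy
      · refine ⟨-1, ?_⟩
        rw [neg_smul, one_smul]
        refine neg_some_eq hx ?_
        simp only [negY, curveE, tateCurve]
        simp
        linear_combination hy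
    · have hx' : x = -(coefE t : Qbar) := by linear_combination hx
      have hy : y = 0 := by
        have : y ^ 2 = 0 := by rw [hx'] at e; linear_combination e
        simpa using this
      refine ⟨2, ?_⟩
      have e2 : (2 : ℤ) • originPt t = (2 : ℕ) • originPt t := by norm_cast
      rw [e2, two_smul_originPt]
      exact some_congr hx' hy
  · obtain ⟨h', e'⟩ := exists_phiFun_some t h h0
    rw [e'] at hP
    exact absurd hP (Point.some_ne_zero _)

lemma two_smul_dualTorsionPt (i : Qbar) (hi : i ^ 2 = -1) :
    (2 : ℕ) • dualTorsionPt t i hi = twoTorsionE' t := by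
  have hA : (coefE' t : Qbar) ≠ 0 := by exact_mod_cast coefE'_ne t
  have hA' := coefE'_eq_Qbar t
  have ht := t_ne_zero_Qbar t
  have hi0 : i ≠ 0 := by rintro rfl; norm_num at hi
  obtain ⟨Y, hY⟩ : ∃ Y, Y = (coefE' t : Qbar) * ((2 + i * (t : Qbar)) / 4) := ⟨_, rfl⟩
  have hnY : ((curveE' t)⁄Qbar).negY (-2 * (coefE' t : Qbar)) Y = Y - coefE' t * i * t / 2 := by
    simp [negY, curveE', tateCurve, hY]
    ring
  have hn : Y ≠ ((curveE' t)⁄Qbar).negY (-2 * (coefE' t : Qbar)) Y := by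
    rw [hnY]
    intro h
    have : (coefE' t : Qbar) * i * t = 0 := by linear_combination 2 * h
    simp [hA, hi0] at this
  have hsl : ((curveE' t)⁄Qbar).slope (-2 * (coefE' t : Qbar)) (-2 * (coefE' t : Qbar)) Y Y =
      -(i * t) / 4 - 1 / 2 := by
    rw [slope_of_Y_ne rfl hn, hnY, div_eq_iff (by
      rw [sub_sub_cancel]
      exact div_ne_zero (mul_ne_zero (mul_ne_zero hA hi0) ht) (by norm_num))]
    simp [curveE', tateCurve, hY]
    rw [hA']
    linear_combination (((t : Qbar) ^ 2 + 4) / 64 * t ^ 2 / 8) * hi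
  rw [two_smul]
  obtain ⟨hq, eq⟩ : ∃ h, dualTorsionPt t i hi = .some (-2 * (coefE' t : Qbar)) Y h := by
    rw [hY]; exact ⟨_, rfl⟩
  have hX : ((curveE' t)⁄Qbar).addX (-2 * (coefE' t : Qbar)) (-2 * (coefE' t : Qbar))
      (-(i * t) / 4 - 1 / 2) = -(coefE' t : Qbar) := by
    simp [addX, curveE', tateCurve]
    rw [hA']
    linear_combination (t : Qbar) ^ 2 / 16 * hi
  rw [eq]
  refine (Point.add_self_of_Y_ne hn).trans (some_congr (by rw [hsl, hX]) ?_)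
  rw [hsl, addY, negAddY, hX, hY]
  simp [negY, curveE', tateCurve]
  ring

lemma four_smul_dualTorsionPt (i : Qbar) (hi : i ^ 2 = -1) :
    (4 : ℕ) • dualTorsionPt t i hi = 0 := by
  have e : (4 : ℕ) • dualTorsionPt t i hi = (2 : ℕ) • (2 : ℕ) • dualTorsionPt t i hi := by
    rw [smul_smul]
    norm_num
  rw [e, two_smul_dualTorsionPt, two_smul]
  exact Point.add_self_of_Y_eq (by simp [negY, curveE', tateCurve])

lemma dualTorsionPt_neg (i : Qbar) (hi : i ^ 2 = -1) (hi' : (-i) ^ 2 = -1) :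
    dualTorsionPt t (-i) hi' = -dualTorsionPt t i hi := by
  refine neg_some_eq rfl ?_
  simp [negY, curveE', tateCurve]
  ring

lemma exists_eq_smul_dualTorsionPt (i : Qbar) (hi : i ^ 2 = -1) (P : PtE' t)
    (hP : dualFun t P = 0) : ∃ m : ℤ, P = m • dualTorsionPt t i hi := by
  rcases P with _ | ⟨x, y, h⟩
  · exact ⟨0, (zero_zsmul _).symm⟩
  have e := (curveE'_nonsingular t).mp h
  by_cases h0 : (x + coefE' t) * (x + 2 * coefE' t) = 0
  · rcases mul_eq_zero.mp h0 with hx | hx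
    · have hx' : x = -(coefE' t : Qbar) := by linear_combination hx
      have hy : y = 0 := by
        have : y ^ 2 = 0 := by rw [hx'] at e; linear_combination e
        simpa using this
      refine ⟨2, ?_⟩
      have e2 : (2 : ℤ) • dualTorsionPt t i hi = (2 : ℕ) • dualTorsionPt t i hi := by norm_cast
      rw [e2, two_smul_dualTorsionPt]
      exact some_congr hx' hy
    · have hx' : x = -2 * (coefE' t : Qbar) := by linear_combination hx
      have hy : (y - (coefE' t : Qbar) * ((2 + i * (t : Qbar)) / 4)) *
          (y - (coefE' t : Qbar) * ((2 + -i * (t : Qbar)) / 4)) = 0 := by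
        have hA := coefE'_eq t
        rw [hx'] at e
        linear_combination e - (coefE' t : Qbar) ^ 2 * t ^ 2 / 16 * hi -
          (coefE' t : Qbar) ^ 2 / 16 * hA
      rcases mul_eq_zero.mp hy with hy | hy
      · refine ⟨1, ?_⟩
        rw [one_smul]
        exact some_congr hx' (sub_eq_zero.mp hy)
      · refine ⟨-1, ?_⟩
        rw [neg_smul, one_smul, ← dualTorsionPt_neg t i hi (by rw [neg_sq, hi])]
        exact some_congr hx' (sub_eq_zero.mp hy)
  · obtain ⟨h', e'⟩ := exists_dualFun_some t h h0
    rw [e'] at hP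
    exact absurd hP (Point.some_ne_zero _)

lemma addOrderOf_eq_four {G : Type*} [AddGroup G] {x : G} (h4 : (4 : ℕ) • x = 0)
    (h2 : (2 : ℕ) • x ≠ 0) : addOrderOf x = 4 :=
  addOrderOf_eq_prime_pow (p := 2) (n := 1) (by simpa using h2) (by simpa using h4)

/-- The generator `T₀` of the kernel of `φ`. -/
def kerGen : equivKer (phiHom t) := ⟨originPt t, phiFun_originPt t⟩

/-- The generator of the kernel of `φ̂` determined by a square root of `-1`. -/
def dualKerGen (i : Qbar) (hi : i ^ 2 = -1) : equivKer (dualHom t) :=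
  ⟨dualTorsionPt t i hi, dualFun_dualTorsionPt t i hi⟩

lemma exists_eq_smul_kerGen (T : equivKer (phiHom t)) : ∃ m : ℤ, T = m • kerGen t := by
  obtain ⟨m, hm⟩ := exists_eq_smul_originPt t T.1 T.2
  exact ⟨m, Subtype.ext hm⟩

lemma exists_eq_smul_dualKerGen (i : Qbar) (hi : i ^ 2 = -1) (T : equivKer (dualHom t)) :
    ∃ m : ℤ, T = m • dualKerGen t i hi := by
  obtain ⟨m, hm⟩ := exists_eq_smul_dualTorsionPt t i hi T.1 T.2
  exact ⟨m, Subtype.ext hm⟩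

lemma addOrderOf_kerGen : addOrderOf (kerGen t) = 4 := by
  refine addOrderOf_eq_four (Subtype.ext (four_smul_originPt t)) fun h => ?_
  have h' : (2 : ℕ) • originPt t = 0 := congrArg Subtype.val h
  rw [two_smul_originPt] at h'
  exact Point.some_ne_zero _ h'

lemma addOrderOf_dualKerGen (i : Qbar) (hi : i ^ 2 = -1) : addOrderOf (dualKerGen t i hi) = 4 := by
  refine addOrderOf_eq_four (Subtype.ext (four_smul_dualTorsionPt t i hi)) fun h => ?_
  have h' : (2 : ℕ) • dualTorsionPt t i hi = 0 := congrArg Subtype.val h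
  rw [two_smul_dualTorsionPt] at h'
  exact Point.some_ne_zero _ h'

lemma smul_zsmul_comm {G M : Type*} [Monoid G] [AddGroup M] [DistribMulAction G M] (g : G) (m : ℤ)
    (x : M) : g • m • x = m • g • x :=
  map_zsmul (DistribSMul.toAddMonoidHom M g) m x

lemma smul_originPt (σ : GQ) : σ • originPt t = originPt t := by
  obtain ⟨h', e⟩ := smul_some (W := curveE t) σ
    ((curveE_nonsingular (F := Qbar) t (x := 0) (y := 0)).mpr (by ring))
  exact e.trans (some_congr (map_zero σ) (map_zero σ))

lemma smul_ker (σ : GQ) (T : equivKer (phiHom t)) : σ • T = T := by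
  obtain ⟨m, rfl⟩ := exists_eq_smul_kerGen t T
  rw [smul_zsmul_comm]
  congr 1
  exact Subtype.ext (smul_originPt t σ)

lemma smul_dualKerGen (σ : GQ) (i : Qbar) (hi : i ^ 2 = -1) :
    σ • dualKerGen t i hi = dualKerGen t (σ i) (by rw [← map_pow, hi, map_neg, map_one]) := by
  refine Subtype.ext ?_
  obtain ⟨h, eq⟩ : ∃ h, dualTorsionPt t i hi = .some (-2 * (coefE' t : Qbar))
    ((coefE' t : Qbar) * ((2 + i * (t : Qbar)) / 4)) h := ⟨_, rfl⟩
  obtain ⟨h', e⟩ := smul_some (W := curveE' t) σ h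
  change σ • dualTorsionPt t i hi = dualTorsionPt t (σ i) (by rw [← map_pow, hi, map_neg, map_one])
  rw [eq]
  refine e.trans (some_congr ?_ ?_)
  all_goals simp only [map_mul, map_add, map_div₀, map_neg, gal_ratCast, map_ofNat]

end Kernels

/-! ### Fourth roots of unity -/

section RootsOfUnity

lemma Mu4.val_injective : Function.Injective Mu4.val := fun _ _ h =>
  Additive.toMul.injective (Subtype.ext (Units.ext h))

lemma Mu4.val_zero : Mu4.val 0 = 1 := rfl

lemma Mu4.val_add (ζ η : Mu4) : (ζ + η).val = ζ.val * η.val := rfl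

lemma Mu4.val_ne_zero (ζ : Mu4) : ζ.val ≠ 0 := Units.ne_zero _

lemma Mu4.val_pow_four (ζ : Mu4) : ζ.val ^ 4 = 1 := by
  have h := ζ.toMul.2
  rw [mem_rootsOfUnity] at h
  exact congrArg Units.val h

lemma Mu4.val_smul (σ : GQ) (ζ : Mu4) : (σ • ζ).val = σ ζ.val := rfl

lemma Mu4.val_neg (ζ : Mu4) : (-ζ).val = ζ.val⁻¹ := by
  exact eq_inv_of_mul_eq_one_left (by rw [← Mu4.val_add, neg_add_cancel, Mu4.val_zero])

lemma Mu4.val_sub (ζ η : Mu4) : (ζ - η).val = ζ.val / η.val := by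
  rw [sub_eq_add_neg, Mu4.val_add, Mu4.val_neg, div_eq_mul_inv]

lemma Mu4.val_zsmul (m : ℤ) (ζ : Mu4) : (m • ζ).val = ζ.val ^ m := by
  change ((((ζ.toMul ^ m : rootsOfUnity 4 Qbar) : Qbarˣ)) : Qbar) = _
  simp [Mu4.val]

lemma Mu4.four_smul (ζ : Mu4) : (4 : ℕ) • ζ = 0 := by
  apply Mu4.val_injective
  have h := Mu4.val_zsmul 4 ζ
  rw [Mu4.val_zero, ← ζ.val_pow_four]
  exact_mod_cast h

/-- A fourth root of unity in `ℚ̄` as an element of `μ₄`. -/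
def Mu4.of (z : Qbar) (hz : z ^ 4 = 1) : Mu4 :=
  Additive.ofMul (rootsOfUnity.mkOfPowEq z hz)

lemma Mu4.val_of (z : Qbar) (hz : z ^ 4 = 1) : (Mu4.of z hz).val = z :=
  rootsOfUnity.val_mkOfPowEq_coe z hz

lemma pow_four_eq_one_of_sq {i : Qbar} (hi : i ^ 2 = -1) : i ^ 4 = 1 := by
  linear_combination (i ^ 2 - 1) * hi

lemma addOrderOf_Mu4_of {i : Qbar} (hi : i ^ 2 = -1) :
    addOrderOf (Mu4.of i (pow_four_eq_one_of_sq hi)) = 4 := by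
  refine addOrderOf_eq_four (Mu4.four_smul _) fun h => ?_
  have := congrArg Mu4.val h
  rw [two_smul, Mu4.val_add, Mu4.val_of, Mu4.val_zero, ← sq, hi] at this
  norm_num at this

lemma exists_eq_smul_Mu4 {i : Qbar} (hi : i ^ 2 = -1) (ζ : Mu4) :
    ∃ m : ℤ, ζ = m • Mu4.of i (pow_four_eq_one_of_sq hi) := by
  have h : (ζ.val - 1) * (ζ.val + 1) * ((ζ.val - i) * (ζ.val + i)) = 0 := by
    linear_combination ζ.val_pow_four - (ζ.val ^ 2 - 1) * hi
  have hi0 : i ≠ 0 := by rintro rfl; norm_num at hi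
  have key : ∃ m : ℤ, ζ.val = i ^ m := by
    rcases mul_eq_zero.mp h with h | h
    · rcases mul_eq_zero.mp h with h | h
      · exact ⟨0, by rw [zpow_zero]; exact sub_eq_zero.mp h⟩
      · refine ⟨2, ?_⟩
        have : i ^ (2 : ℤ) = i ^ (2 : ℕ) := by norm_cast
        rw [this, hi]
        linear_combination h
    · rcases mul_eq_zero.mp h with h | h
      · exact ⟨1, by rw [zpow_one]; exact sub_eq_zero.mp h⟩
      · refine ⟨-1, ?_⟩
        rw [zpow_neg_one]
        field_simp
        linear_combination i * h - hi
  obtain ⟨m, hm⟩ := key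
  exact ⟨m, Mu4.val_injective (by rw [hm, Mu4.val_zsmul, Mu4.val_of])⟩

lemma exists_sq_eq_neg_one : ∃ i : Qbar, i ^ 2 = -1 :=
  IsAlgClosed.exists_pow_nat_eq (-1) (by norm_num)

end RootsOfUnity

/-! ### Bilinear maps on cyclic groups and alternating forms on extensions -/

section Algebra

/-- A homomorphism `f` with values killed by `4` extends to a bilinear map whose second variable
runs over a cyclic group of order `4`. -/
lemma exists_bilinear_of_cyclic {A B C : Type*} [AddCommGroup A] [AddCommGroup B] [AddCommGroup C]
    {T : C} (hT : ∀ x : C, ∃ m : ℤ, x = m • T) (h4 : addOrderOf T = 4) (f : A →+ B)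
    (hf : ∀ a, (4 : ℤ) • f a = 0) :
    ∃ e : A →+ C →+ B, ∀ a (m : ℤ), e a (m • T) = m • f a := by
  choose m hm using hT
  have key : ∀ (k l : ℤ) (a : A), k • T = l • T → k • f a = l • f a := by
    intro k l a h
    have h' : (k - l) • T = 0 := by rw [sub_smul, h, sub_self]
    rw [← addOrderOf_dvd_iff_zsmul_eq_zero, h4] at h'
    obtain ⟨d, hd⟩ := h'
    rw [← sub_eq_zero, ← sub_smul, hd, mul_comm, mul_smul]
    push_cast
    rw [hf, smul_zero]
  refine ⟨AddMonoidHom.mk' (fun a => AddMonoidHom.mk' (fun x => m x • f a) fun x y => ?_)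
    fun a b => ?_, fun a k => ?_⟩
  · rw [← add_smul]
    exact key _ _ a (by rw [add_smul, ← hm, ← hm, ← hm])
  · ext x
    change m x • f (a + b) = m x • f a + m x • f b
    rw [map_add, smul_add]
  · exact key _ _ a (hm _).symm

/-- The isomorphism of a cyclic group of order `4` with `ℤ/4` attached to a generator. -/
lemma exists_equiv_zmod_four {C : Type*} [AddCommGroup C] {T : C} (hT : ∀ x : C, ∃ m : ℤ, x = m • T)
    (h4 : addOrderOf T = 4) : ∃ θ : C ≃+ ZMod 4, θ T = 1 :=
  ⟨addEquivOfAddOrderOfEq (g := T) (g' := 1)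
    (fun x => by
      obtain ⟨m, hm⟩ := hT x
      exact ⟨m, hm.symm⟩)
    (fun x => ⟨x.val, by simp⟩) (by rw [h4, ZMod.addOrderOf_one]),
    addEquivOfAddOrderOfEq_apply_gen _ _ _⟩

/-- Let `M` be a Galois module killed by `4`, with a surjection `ε` onto a cyclic group `μ` of order
`4` whose kernel is generated by an invariant element `T` of order `4`. In coordinates `(n, m)` on
`M ≃ (ℤ/4)²` given by a lift of a generator of `μ` and by `T`, the determinant is an alternating
form. It is equivariant because an automorphism acts by a triangular matrix, with diagonal entries
its character on `μ` and `1`. -/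
lemma exists_alternating_of_extension {G M μ : Type*} [Group G] [AddCommGroup M] [AddCommGroup μ]
    [DistribMulAction G M] [DistribMulAction G μ] (ε : M →+[G] μ) (hε : Function.Surjective ε)
    (hM : ∀ S : M, (4 : ℕ) • S = 0) {z : μ} (hz : ∀ x : μ, ∃ m : ℤ, x = m • z)
    (hz4 : addOrderOf z = 4) {T : M} (hT4 : addOrderOf T = 4) (hTG : ∀ σ : G, σ • T = T)
    (hεT : ε T = 0) (hker : ∀ S, ε S = 0 → ∃ m : ℤ, S = m • T) :
    ∃ e : M →+ M →+ μ, (∀ S, e S S = 0) ∧ (∀ S, (∀ R, e S R = 0) → S = 0) ∧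
      (∀ (σ : G) (S R : M), e (σ • S) (σ • R) = σ • e S R) ∧
      ∀ (S : M) (m : ℤ), e S (m • T) = m • ε S := by
  obtain ⟨θ, hθ⟩ := exists_equiv_zmod_four hz hz4
  obtain ⟨S₁, hS₁⟩ := hε z
  let s : ZMod 4 →+ M := ZMod.lift 4 ⟨zmultiplesHom M S₁, (natCast_zsmul S₁ 4).trans (hM S₁)⟩
  let j : ZMod 4 →+ M := ZMod.lift 4 ⟨zmultiplesHom M T, (natCast_zsmul T 4).trans (hM T)⟩
  have hs : ∀ k : ℤ, s k = k • S₁ := fun k => by simp [s]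
  have hj : ∀ k : ℤ, j k = k • T := fun k => by simp [j]
  have hjinj : Function.Injective j := by
    rw [injective_iff_map_eq_zero]
    intro a ha
    obtain ⟨k, rfl⟩ := ZMod.intCast_surjective a
    rw [hj, ← addOrderOf_dvd_iff_zsmul_eq_zero, hT4] at ha
    exact (ZMod.intCast_zmod_eq_zero_iff_dvd k 4).mpr ha
  let n : M →+ ZMod 4 := (θ : μ →+ ZMod 4).comp (ε : M →+ μ)
  have hn : ∀ S, n S = θ (ε S) := fun S => rfl
  have hns : ∀ a, n (s a) = a := by
    intro a
    obtain ⟨k, rfl⟩ := ZMod.intCast_surjective a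
    rw [hs, map_zsmul, hn, hS₁, hθ]
    simp
  have hnT : n T = 0 := by rw [hn, hεT, map_zero]
  -- the complementary coordinate
  have hex : ∀ S, ∃ a, S = s (n S) + j a := by
    intro S
    obtain ⟨k, hk⟩ := hker (S - s (n S)) (by
      apply θ.injective
      rw [← hn, map_sub, hns, sub_self, map_zero])
    exact ⟨k, by rw [hj, ← hk]; abel⟩
  choose m hm using hex
  have hmadd : ∀ S R, m (S + R) = m S + m R := by
    intro S R
    apply hjinj
    have h1 := hm (S + R)
    rw [map_add n, map_add s] at h1
    have h2 : S + R = s (n S) + s (n R) + (j (m S) + j (m R)) := by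
      conv_lhs => rw [hm S, hm R]
      abel
    rw [map_add j]
    exact add_left_cancel (h1.symm.trans h2)
  let m' : M →+ ZMod 4 := AddMonoidHom.mk' m hmadd
  have hm' : ∀ S, m' S = m S := fun S => rfl
  have hmT : m T = 1 := by
    apply hjinj
    have h := hm T
    rw [hnT, map_zero, zero_add] at h
    rw [← h]
    simpa using (hj 1).symm
  have hmS₁ : m S₁ = 0 := by
    apply hjinj
    have h := hm S₁
    have h1 : s (n S₁) = S₁ := by rw [hn, hS₁, hθ]; simpa using hs 1
    rw [h1] at h
    rw [map_zero]
    exact (left_eq_add.mp h)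
  have hnS₁ : n S₁ = 1 := by rw [hn, hS₁, hθ]
  -- a homomorphism that vanishes at `S₁` and `T` is determined by its coordinates
  have hexp : ∀ (f : M →+ ZMod 4) (S : M), f S = n S * f S₁ + m S * f T := by
    intro f S
    obtain ⟨k, hk⟩ := ZMod.intCast_surjective (n S)
    obtain ⟨l, hl⟩ := ZMod.intCast_surjective (m S)
    conv_lhs => rw [hm S]
    rw [← hk, ← hl, hs, hj, map_add, map_zsmul, map_zsmul]
    simp
  refine ⟨AddMonoidHom.mk' (fun S => AddMonoidHom.mk' (fun R => θ.symm (n S * m' R - m' S * n R))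
    fun R R' => ?_) fun S S' => ?_, fun S => ?_, fun S hS => ?_, fun σ S R => ?_, fun S k => ?_⟩
  · rw [← map_add]
    congr 1
    rw [map_add, map_add]; ring
  · ext R
    change θ.symm _ = θ.symm _ + θ.symm _
    rw [← map_add]
    congr 1
    rw [map_add, map_add]; ring
  · change θ.symm (n S * m' S - m' S * n S) = 0
    rw [mul_comm, sub_self, map_zero]
  · have h0 : ∀ R, n S * m' R - m' S * n R = 0 := fun R => by
      have h : θ.symm (n S * m' R - m' S * n R) = 0 := hS R
      exact θ.symm.injective (h.trans (map_zero _).symm)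
    have h1 := h0 T
    have h2 := h0 S₁
    rw [hm', hmT, hnT] at h1
    rw [hm', hmS₁, hnS₁] at h2
    have e1 : n S = 0 := by simpa using h1
    have e2 : m S = 0 := by simpa [hm'] using h2
    rw [hm S, e1, e2, map_zero, map_zero, add_zero]
  · change θ.symm (n (σ • S) * m' (σ • R) - m' (σ • S) * n (σ • R)) =
      σ • θ.symm (n S * m' R - m' S * n R)
    let σM : M →+ M := DistribSMul.toAddMonoidHom M σ
    have hnσ : ∀ S, n (σ • S) = n S * n (σ • S₁) := by
      intro S
      have h := hexp (n.comp σM) S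
      have hT' : n.comp σM T = 0 := by
        change n (σ • T) = 0
        rw [hTG, hnT]
      rw [hT', mul_zero, add_zero] at h
      exact h
    have hmσ : ∀ S, m' (σ • S) = n S * m' (σ • S₁) + m S := by
      intro S
      have h := hexp (m'.comp σM) S
      have hT' : m'.comp σM T = 1 := by
        change m (σ • T) = 1
        rw [hTG, hmT]
      rw [hT', mul_one] at h
      exact h
    have hμ : ∀ a : ZMod 4, σ • θ.symm a = θ.symm (a * n (σ • S₁)) := by
      intro a
      have ha : θ.symm a = ε (s a) := by
        apply θ.injective
        rw [← hn, hns]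
        simp
      rw [ha, ← map_smul]
      apply θ.injective
      rw [← hn, hnσ, hns]
      simp
    rw [hμ, hnσ S, hnσ R, hmσ S, hmσ R, hm' S, hm' R]
    congr 1
    ring
  · change θ.symm (n S * m' (k • T) - m' S * n (k • T)) = k • ε S
    apply θ.injective
    rw [map_zsmul, map_zsmul, hm', hmT, hnT, map_zsmul, ← hn]
    simp [mul_comm]

end Algebra

/-! ### First cohomology groups -/

section Cohomology

variable {G M N : Type*} [Group G] [TopologicalSpace G] [AddCommGroup M] [DistribMulAction G M]
  [AddCommGroup N] [DistribMulAction G N]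

lemma GalH1.mk_eq_mk_iff (c d : ContCocycle G M) :
    GalH1.mk c = GalH1.mk d ↔ ∃ m : M, ∀ σ : G, c.1 σ - d.1 σ = σ • m - m := by
  refine QuotientAddGroup.eq_iff_sub_mem.trans ?_
  exact Iff.rfl

lemma GalH1.mk_surjective : Function.Surjective (GalH1.mk (G := G) (M := M)) :=
  QuotientAddGroup.mk_surjective

lemma GalH1.map_mk (f : M →+[G] N) (c : ContCocycle G M) :
    GalH1.map f (GalH1.mk c) = GalH1.mk (ContCocycle.map f c) := rfl

lemma GalH1.mk_add (c d : ContCocycle G M) : GalH1.mk (c + d) = GalH1.mk c + GalH1.mk d := rfl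

lemma GalH1.map_bijective (f : M →+[G] N) (hf : Function.Bijective f) :
    Function.Bijective (GalH1.map f) := by
  constructor
  · rw [injective_iff_map_eq_zero]
    intro x hx
    obtain ⟨c, rfl⟩ := GalH1.mk_surjective x
    have hx' : GalH1.mk (ContCocycle.map f c) = GalH1.mk 0 := hx
    obtain ⟨n, hn⟩ := (GalH1.mk_eq_mk_iff _ _).mp hx'
    obtain ⟨m, rfl⟩ := hf.2 n
    refine (GalH1.mk_eq_mk_iff c 0).mpr ⟨m, fun σ => hf.1 ?_⟩
    have h : f (c.1 σ) - 0 = σ • f m - f m := hn σ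
    change f (c.1 σ - 0) = _
    rw [sub_zero] at h ⊢
    rw [h, map_sub, map_smul]
  · intro y
    obtain ⟨d, rfl⟩ := GalH1.mk_surjective y
    choose g hg using hf.2
    refine ⟨GalH1.mk ⟨fun σ => g (d.1 σ), d.2.1.comp g, fun σ τ => hf.1 ?_⟩, ?_⟩
    · rw [map_add, map_smul, hg, hg, hg, d.2.2]
    · rw [GalH1.map_mk]
      congr 1
      exact Subtype.ext (funext fun σ => hg _)

end Cohomology

/-! ### Continuity of the Galois action -/

section Continuity

/-- For the algebra structure on `ℚ̄` that comes from characteristic zero, which is not reducibly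
the one of its construction as an algebraic closure. -/
instance isAlgClosure_Qbar : IsAlgClosure ℚ Qbar where
  isAlgClosed := inferInstance
  isAlgebraic := by
    have h := AlgebraicClosure.isAlgebraic ℚ
    convert h
    all_goals rfl

instance isAlgebraic_Qbar : Algebra.IsAlgebraic ℚ Qbar := IsAlgClosure.isAlgebraic

instance isGalois_Qbar : IsGalois ℚ Qbar := IsAlgClosure.isGalois ℚ Qbar

lemma isLocallyConstant_gal_apply (x : Qbar) : IsLocallyConstant fun σ : GQ => σ x := by
  rw [IsLocallyConstant.iff_exists_open]
  intro σ
  have : FiniteDimensional ℚ (IntermediateField.adjoin ℚ {x}) :=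
    IntermediateField.adjoin.finiteDimensional (Algebra.IsIntegral.isIntegral x)
  refine ⟨(fun τ => σ⁻¹ * τ) ⁻¹' (IntermediateField.adjoin ℚ {x}).fixingSubgroup,
    (IntermediateField.fixingSubgroup_isOpen _).preimage (continuous_const_mul σ⁻¹), by simp, ?_⟩
  intro τ hτ
  have h := (IntermediateField.mem_fixingSubgroup_iff _ _).mp hτ x
    (IntermediateField.mem_adjoin_simple_self ℚ x)
  have h' : σ (σ⁻¹ (τ x)) = σ x := congrArg σ h
  rwa [← AlgEquiv.mul_apply, mul_inv_cancel, AlgEquiv.one_apply] at h'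

lemma isLocallyConstant_smul_point {W : WeierstrassCurve ℚ} (P : (W⁄Qbar).Point) :
    IsLocallyConstant fun σ : GQ => σ • P := by
  rcases P with _ | ⟨x, y, h⟩
  · exact IsLocallyConstant.const _
  · rw [IsLocallyConstant.iff_exists_open]
    intro σ
    refine ⟨{τ | τ x = σ x} ∩ {τ | τ y = σ y},
      ((isLocallyConstant_gal_apply x).isOpen_fiber _).inter
        ((isLocallyConstant_gal_apply y).isOpen_fiber _), ⟨rfl, rfl⟩, ?_⟩
    rintro τ ⟨h₁, h₂⟩
    exact some_congr h₁ h₂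

/-- The crossed homomorphism `σ ↦ σ P - P` with values in the kernel of `ψ`, for a point `P` whose
image under `ψ` is Galois invariant. -/
def pointCocycle {W W' : WeierstrassCurve ℚ} (ψ : (W'⁄Qbar).Point →+[GQ] (W⁄Qbar).Point)
    (P : (W'⁄Qbar).Point) (hP : ∀ σ : GQ, σ • ψ P = ψ P) : ContCocycle GQ (equivKer ψ) :=
  ⟨fun σ => ⟨σ • P - P, by
    change ψ (σ • P - P) = 0
    rw [map_sub, map_smul, hP, sub_self]⟩, by
    refine IsLocallyConstant.desc _ Subtype.val ?_ Subtype.val_injective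
    exact (isLocallyConstant_smul_point P).sub (IsLocallyConstant.const P), fun σ τ => by
    refine Subtype.ext ?_
    change (σ * τ) • P - P = σ • P - P + σ • (τ • P - P)
    rw [smul_sub, mul_smul]
    abel⟩

lemma pointCocycle_apply {W W' : WeierstrassCurve ℚ} (ψ : (W'⁄Qbar).Point →+[GQ] (W⁄Qbar).Point)
    (P : (W'⁄Qbar).Point) (hP : ∀ σ : GQ, σ • ψ P = ψ P) (σ : GQ) :
    (((pointCocycle ψ P hP).1 σ : equivKer ψ) : (W'⁄Qbar).Point) = σ • P - P := rfl

lemma smul_ratPoint (W : WeierstrassCurve ℚ) (σ : GQ) (P : (W⁄ℚ).Point) :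
    σ • ratPoint W P = ratPoint W P := by
  rcases P with _ | ⟨x, y, h⟩
  · rfl
  · exact some_congr (σ.commutes x) (σ.commutes y)

lemma exists_ratPoint_of_fixed {W : WeierstrassCurve ℚ} (P : (W⁄Qbar).Point)
    (hP : ∀ σ : GQ, σ • P = P) : ∃ Q, ratPoint W Q = P := by
  rcases P with _ | ⟨x, y, h⟩
  · exact ⟨0, map_zero _⟩
  · have hx : ∀ σ : GQ, σ x = x := fun σ => (Point.some.inj (hP σ)).1
    have hy : ∀ σ : GQ, σ y = y := fun σ => (Point.some.inj (hP σ)).2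
    obtain ⟨x, rfl⟩ := (InfiniteGalois.mem_range_algebraMap_iff_fixed x).mpr hx
    obtain ⟨y, rfl⟩ := (InfiniteGalois.mem_range_algebraMap_iff_fixed y).mpr hy
    have h' : (W⁄ℚ).Nonsingular x y :=
      (W.toAffine.baseChange_nonsingular (f := Algebra.ofId ℚ Qbar)
        (Algebra.ofId ℚ Qbar).injective x y).mp h
    exact ⟨.some x y h', rfl⟩

/-- The connecting homomorphism `P ↦ [σ ↦ σ P' - P']`, where `ψ P' = P`; it is injective. -/
lemma exists_connectingMap {W W' : WeierstrassCurve ℚ} (ψ : (W'⁄Qbar).Point →+[GQ] (W⁄Qbar).Point)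
    (hψ : Function.Surjective ψ) :
    ∃ δ : (W⁄ℚ).Point ⧸ ratImage ψ →+ GalH1 GQ (equivKer ψ),
      IsConnectingMap ψ δ ∧ Function.Injective δ := by
  have hfix : ∀ {P : (W⁄ℚ).Point} {P' : (W'⁄Qbar).Point}, ψ P' = ratPoint W P →
      ∀ σ : GQ, σ • ψ P' = ψ P' := fun h σ => by rw [h, smul_ratPoint]
  choose l hl using fun P => hψ (ratPoint W P)
  -- the class does not depend on the choice of `P'`
  have hind : ∀ (P' Q' : (W'⁄Qbar).Point) (h) (h'), ψ P' = ψ Q' →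
      GalH1.mk (pointCocycle ψ P' h) = GalH1.mk (pointCocycle ψ Q' h') := by
    intro P' Q' h h' e
    rw [GalH1.mk_eq_mk_iff]
    refine ⟨⟨P' - Q', by change ψ _ = 0; rw [map_sub, e, sub_self]⟩, fun σ => Subtype.ext ?_⟩
    change (σ • P' - P') - (σ • Q' - Q') = σ • (P' - Q') - (P' - Q')
    rw [smul_sub]; abel
  have hadd : ∀ (P' Q' : (W'⁄Qbar).Point) (h) (h') (h''),
      GalH1.mk (pointCocycle ψ (P' + Q') h'') =
        GalH1.mk (pointCocycle ψ P' h) + GalH1.mk (pointCocycle ψ Q' h') := by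
    intro P' Q' h h' h''
    rw [← GalH1.mk_add]
    congr 1
    refine Subtype.ext (funext fun σ => Subtype.ext ?_)
    change σ • (P' + Q') - (P' + Q') = (σ • P' - P') + (σ • Q' - Q')
    rw [smul_add]; abel
  let δ₀ : (W⁄ℚ).Point →+ GalH1 GQ (equivKer ψ) :=
    AddMonoidHom.mk' (fun P => GalH1.mk (pointCocycle ψ (l P) (hfix (hl P)))) fun P Q => by
      rw [← hadd (h'' := hfix (P := P + Q) (by rw [map_add, map_add, hl, hl]))]
      exact hind _ _ _ _ (by rw [map_add, hl, hl, hl, map_add])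
  have hδ₀ : ∀ P (P' : (W'⁄Qbar).Point) (h : ψ P' = ratPoint W P),
      δ₀ P = GalH1.mk (pointCocycle ψ P' (hfix h)) := fun P P' h =>
    hind _ _ _ _ (by rw [hl, h])
  have hker : ∀ P, δ₀ P = 0 ↔ P ∈ ratImage ψ := by
    intro P
    constructor
    · intro h
      rw [hδ₀ P (l P) (hl P)] at h
      obtain ⟨T, hT⟩ := (GalH1.mk_eq_mk_iff _ 0).mp h
      obtain ⟨Q, hQ⟩ := exists_ratPoint_of_fixed (l P - T.1) (fun σ => by
        have h1 : σ • l P - l P - 0 = σ • T.1 - T.1 := congrArg Subtype.val (hT σ)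
        rw [sub_zero] at h1
        rw [smul_sub, ← sub_eq_zero]
        rw [← sub_eq_zero] at h1
        rw [← h1]
        abel)
      refine ⟨ratPoint W' Q, ⟨Q, rfl⟩, ?_⟩
      have hT0 : ψ T.1 = 0 := T.2
      change ψ (ratPoint W' Q) = ratPoint W P
      rw [hQ, map_sub, hT0, sub_zero, hl]
    · rintro ⟨_, ⟨Q, rfl⟩, hQ⟩
      rw [hδ₀ P (ratPoint W' Q) hQ]
      refine (GalH1.mk_eq_mk_iff _ 0).mpr ⟨0, fun σ => Subtype.ext ?_⟩
      change (σ • ratPoint W' Q - ratPoint W' Q) - 0 = σ • 0 - 0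
      rw [smul_ratPoint, smul_zero]
      abel
  refine ⟨QuotientAddGroup.lift _ δ₀ fun P hP => (hker P).mpr hP, fun P P' h => ?_, ?_⟩
  · exact ⟨pointCocycle ψ P' (hfix h), pointCocycle_apply ψ P' _, hδ₀ P P' h⟩
  · rw [injective_iff_map_eq_zero]
    intro p hp
    obtain ⟨P, rfl⟩ := QuotientAddGroup.mk_surjective p
    exact (QuotientAddGroup.eq_zero_iff P).mpr ((hker P).mp hp)

end Continuity

/-! ### Kummer theory -/

section Kummer

/-- The crossed homomorphism `σ ↦ σ β / β` attached to a fourth root `β` of a rational number. -/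
def kummerCocycle (d : ℚˣ) (β : Qbar) (h : β ^ 4 = algebraMap ℚ Qbar d) : ContCocycle GQ Mu4 :=
  have hβ : β ≠ 0 := by
    rintro rfl
    have : algebraMap ℚ Qbar d = 0 := by rw [← h]; norm_num
    simp at this
  have hd : ∀ σ : GQ, (σ β / β) ^ 4 = 1 := fun σ => by
    rw [div_pow, ← map_pow, h, σ.commutes, div_self]
    rw [← h]
    exact pow_ne_zero 4 hβ
  ⟨fun σ => Mu4.of (σ β / β) (hd σ), by
    refine IsLocallyConstant.desc _ Mu4.val ?_ Mu4.val_injective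
    have : (Mu4.val ∘ fun σ : GQ => Mu4.of (σ β / β) (hd σ)) = (fun z => z / β) ∘ fun σ => σ β :=
      funext fun σ => Mu4.val_of _ _
    rw [this]
    exact (isLocallyConstant_gal_apply β).comp _, fun σ τ => by
    apply Mu4.val_injective
    rw [Mu4.val_add, Mu4.val_smul, Mu4.val_of, Mu4.val_of, Mu4.val_of, map_div₀,
      AlgEquiv.mul_apply]
    have : σ β ≠ 0 := (map_ne_zero σ).mpr hβ
    field_simp⟩

lemma kummerCocycle_val (d : ℚˣ) (β : Qbar) (h : β ^ 4 = algebraMap ℚ Qbar d) (σ : GQ) :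
    ((kummerCocycle d β h).1 σ).val = σ β / β := Mu4.val_of _ _

lemma ne_zero_of_pow_eq_unit {d : ℚˣ} {β : Qbar} (h : β ^ 4 = algebraMap ℚ Qbar d) : β ≠ 0 := by
  rintro rfl
  have : algebraMap ℚ Qbar d = 0 := by rw [← h]; norm_num
  simp at this

/-- Hilbert's Theorem 90 for continuous cocycles of an infinite Galois group: by the independence of
characters some Lagrange resolvent of the cocycle does not vanish. -/
lemma exists_eq_div_of_cocycle {k K : Type*} [Field k] [Field K] [Algebra k K] [Normal k K]
    (c : Gal(K/k) → K) (hloc : IsLocallyConstant c) (h0 : ∀ σ, c σ ≠ 0)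
    (hmul : ∀ σ τ, c (σ * τ) = c σ * σ (c τ)) : ∃ β : K, β ≠ 0 ∧ ∀ σ, c σ = σ β / β := by
  have hc1 : c 1 = 1 := by
    have h := hmul 1 1
    rw [mul_one, AlgEquiv.one_apply] at h
    exact left_eq_mul₀ (h0 1) |>.mp h
  have hnhds : {σ : Gal(K/k) | c σ = 1} ∈ nhds (1 : Gal(K/k)) :=
    (hloc.isOpen_fiber 1).mem_nhds hc1
  obtain ⟨E, hfin, hnorm, hE⟩ := (krullTopology_mem_nhds_one_iff_of_normal k K _).mp hnhds
  let r : Gal(K/k) →* Gal(E/k) := AlgEquiv.restrictNormalHom E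
  have hr : Function.Surjective r := AlgEquiv.restrictNormalHom_surjective K
  have hrx : ∀ (σ : Gal(K/k)) (x : E), ((r σ x : E) : K) = σ x := fun σ x =>
    AlgEquiv.restrictNormal_apply E σ x
  have hfac : ∀ σ τ : Gal(K/k), r σ = r τ → c σ = c τ := by
    intro σ τ h
    have h1 : c (τ⁻¹ * σ) = 1 := hE (by
      rw [SetLike.mem_coe, IntermediateField.mem_fixingSubgroup_iff]
      intro x hx
      have h2 : r (τ⁻¹ * σ) = 1 := by rw [map_mul, map_inv, h, inv_mul_cancel]
      have h3 := hrx (τ⁻¹ * σ) ⟨x, hx⟩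
      rw [h2] at h3
      exact h3.symm)
    have h2 := hmul τ (τ⁻¹ * σ)
    rwa [mul_inv_cancel_left, h1, map_one, mul_one] at h2
  choose s hs using hr
  let χ : Gal(E/k) → (E →* K) := fun τ => (algebraMap E K : E →* K).comp (τ : E →* E)
  have hχ : Function.Injective χ := by
    intro τ τ' h
    refine AlgEquiv.ext fun x => ?_
    exact (algebraMap E K).injective (DFunLike.congr_fun h x)
  have hind := (linearIndependent_monoidHom E K).comp χ hχ
  rw [Fintype.linearIndependent_iff] at hind
  obtain ⟨x, hx⟩ : ∃ x : E, ∑ τ : Gal(E/k), c (s τ) * ((τ x : E) : K) ≠ 0 := by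
    by_contra hcon
    push Not at hcon
    refine h0 _ (hind (fun τ => c (s τ)) (funext fun x => ?_) 1)
    rw [Finset.sum_apply]
    exact hcon x
  have key : ∀ σ : Gal(K/k), σ (∑ τ : Gal(E/k), c (s τ) * ((τ x : E) : K)) * c σ =
      ∑ τ : Gal(E/k), c (s τ) * ((τ x : E) : K) := by
    intro σ
    rw [map_sum, Finset.sum_mul]
    refine Fintype.sum_equiv (Equiv.mulLeft (r σ)) _ _ fun τ => ?_
    have h1 : c (s (r σ * τ)) = c σ * σ (c (s τ)) := by
      rw [← hmul]
      apply hfac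
      rw [hs, map_mul, hs]
    rw [Equiv.coe_mulLeft, h1, map_mul, AlgEquiv.mul_apply, hrx]
    ring
  refine ⟨(∑ τ : Gal(E/k), c (s τ) * ((τ x : E) : K))⁻¹, inv_ne_zero hx, fun σ => ?_⟩
  have hσ : σ (∑ τ : Gal(E/k), c (s τ) * ((τ x : E) : K)) ≠ 0 := (map_ne_zero σ).mpr hx
  rw [map_inv₀, div_inv_eq_mul, eq_inv_mul_iff_mul_eq₀ hσ]
  exact key σ

/-- The Kummer isomorphism `ℚˣ / (ℚˣ)⁴ ≃ H¹(G_ℚ, μ₄)`. -/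
lemma exists_kummerMap : ∃ κ : QModFourth ≃+ GalH1 GQ Mu4,
    IsKummerMap (κ : QModFourth →+ GalH1 GQ Mu4) := by
  choose l hl using fun d : ℚˣ =>
    IsAlgClosed.exists_pow_nat_eq (algebraMap ℚ Qbar d) (n := 4) (by norm_num)
  -- the class does not depend on the choice of the fourth root
  have hind : ∀ (d : ℚˣ) (β γ : Qbar) (h : β ^ 4 = algebraMap ℚ Qbar d)
      (h' : γ ^ 4 = algebraMap ℚ Qbar d),
      GalH1.mk (kummerCocycle d β h) = GalH1.mk (kummerCocycle d γ h') := by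
    intro d β γ h h'
    have hβ := ne_zero_of_pow_eq_unit h
    have hγ := ne_zero_of_pow_eq_unit h'
    rw [GalH1.mk_eq_mk_iff]
    refine ⟨Mu4.of (β / γ) (by rw [div_pow, h, h', div_self]; rw [← h]; exact pow_ne_zero 4 hβ),
      fun σ => Mu4.val_injective ?_⟩
    rw [Mu4.val_sub, Mu4.val_sub, Mu4.val_smul, Mu4.val_of, kummerCocycle_val, kummerCocycle_val,
      map_div₀]
    have : σ γ ≠ 0 := (map_ne_zero σ).mpr hγ
    field_simp
  have hmul : ∀ d e : ℚˣ, GalH1.mk (kummerCocycle (d * e) (l (d * e)) (hl _)) =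
      GalH1.mk (kummerCocycle d (l d) (hl _)) + GalH1.mk (kummerCocycle e (l e) (hl _)) := by
    intro d e
    rw [hind (d * e) (l (d * e)) (l d * l e) (hl _)
      (by rw [mul_pow, hl, hl, ← map_mul, Units.val_mul]), ← GalH1.mk_add]
    congr 1
    refine Subtype.ext (funext fun σ => Mu4.val_injective ?_)
    change _ = ((kummerCocycle d (l d) (hl _)).1 σ + (kummerCocycle e (l e) (hl _)).1 σ).val
    rw [Mu4.val_add, kummerCocycle_val, kummerCocycle_val, kummerCocycle_val, map_mul,
      mul_div_mul_comm]
  let κ₀ : ℚˣ →* Multiplicative (GalH1 GQ Mu4) :=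
    MonoidHom.mk' (fun d => Multiplicative.ofAdd (GalH1.mk (kummerCocycle d (l d) (hl d)))) hmul
  have hκ₀ : ∀ d, κ₀ d = 1 ↔ d ∈ (powMonoidHom 4 : ℚˣ →* ℚˣ).range := by
    intro d
    constructor
    · intro h
      obtain ⟨ζ, hζ⟩ := (GalH1.mk_eq_mk_iff (kummerCocycle d (l d) (hl d)) 0).mp h
      have hl0 := ne_zero_of_pow_eq_unit (hl d)
      obtain ⟨q, hq⟩ :=
          (InfiniteGalois.mem_range_algebraMap_iff_fixed (l d / ζ.val)).mpr fun σ => by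
        have h1 : ((kummerCocycle d (l d) (hl d)).1 σ - 0).val = (σ • ζ - ζ).val :=
          congrArg Mu4.val (hζ σ)
        rw [sub_zero, kummerCocycle_val, Mu4.val_sub, Mu4.val_smul] at h1
        have hζ0 := ζ.val_ne_zero
        have : σ ζ.val ≠ 0 := (map_ne_zero σ).mpr hζ0
        rw [map_div₀, div_eq_div_iff this hζ0]
        rw [div_eq_div_iff hl0 hζ0] at h1
        linear_combination h1
      have hq4 : q ^ 4 = (d : ℚ) := by
        apply (algebraMap ℚ Qbar).injective
        rw [map_pow, hq, div_pow, hl, ζ.val_pow_four, div_one]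
      have hq0 : q ≠ 0 := by
        rintro rfl
        exact d.ne_zero (by rw [← hq4]; norm_num)
      exact ⟨Units.mk0 q hq0, Units.ext (by simpa using hq4)⟩
    · rintro ⟨q, rfl⟩
      have hq : (algebraMap ℚ Qbar q) ^ 4 = algebraMap ℚ Qbar (powMonoidHom 4 q : ℚˣ) := by
        simp
      have h1 := hind _ _ _ (hl (powMonoidHom 4 q)) hq
      refine h1.trans ?_
      refine (GalH1.mk_eq_mk_iff _ 0).mpr ⟨0, fun σ => Mu4.val_injective ?_⟩
      change ((kummerCocycle _ _ hq).1 σ - 0).val = (σ • (0 : Mu4) - 0).val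
      rw [sub_zero, kummerCocycle_val, smul_zero, sub_zero, Mu4.val_zero, σ.commutes, div_self]
      exact ne_zero_of_pow_eq_unit hq
  let κ₁ : QModFourth →+ GalH1 GQ Mu4 := MonoidHom.toAdditiveLeft
    (QuotientGroup.lift _ κ₀ fun d hd => (hκ₀ d).mpr hd)
  have hκ₁ : ∀ d, κ₁ (QModFourth.mk d) = GalH1.mk (kummerCocycle d (l d) (hl d)) := fun d => rfl
  have hmk : ∀ x : QModFourth, ∃ d, QModFourth.mk d = x := fun x =>
    QuotientGroup.mk_surjective (Additive.toMul x)
  have hbij : Function.Bijective κ₁ := by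
    constructor
    · rw [injective_iff_map_eq_zero]
      intro x hx
      obtain ⟨d, rfl⟩ := hmk x
      exact (QuotientGroup.eq_one_iff d).mpr ((hκ₀ d).mp hx)
    · intro y
      obtain ⟨c, rfl⟩ := GalH1.mk_surjective y
      obtain ⟨β, hβ, h⟩ := exists_eq_div_of_cocycle (fun σ => (c.1 σ).val) (c.2.1.comp Mu4.val)
        (fun σ => (c.1 σ).val_ne_zero) (fun σ τ => by rw [c.2.2, Mu4.val_add, Mu4.val_smul])
      obtain ⟨d, hd⟩ := (InfiniteGalois.mem_range_algebraMap_iff_fixed (β ^ 4)).mpr fun σ => by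
        have h1 := (c.1 σ).val_pow_four
        rw [show (c.1 σ).val = _ from h σ, div_pow, div_eq_one_iff_eq (pow_ne_zero 4 hβ)] at h1
        rw [map_pow, h1]
      have hd0 : d ≠ 0 := by
        rintro rfl
        rw [map_zero] at hd
        exact pow_ne_zero 4 hβ hd.symm
      have hβd : β ^ 4 = algebraMap ℚ Qbar (Units.mk0 d hd0 : ℚˣ) := hd.symm
      refine ⟨QModFourth.mk (Units.mk0 d hd0), ?_⟩
      rw [hκ₁, hind _ _ β _ hβd]
      congr 1
      refine Subtype.ext (funext fun σ => Mu4.val_injective ?_)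
      exact (kummerCocycle_val _ _ _ σ).trans (h σ).symm
  exact ⟨AddEquiv.ofBijective κ₁ hbij, fun d β h =>
    ⟨kummerCocycle d β h, kummerCocycle_val d β h, (hκ₁ d).trans (hind _ _ _ _ _)⟩⟩

end Kummer

/-! ### The isomorphism of the kernel of `φ̂` with `μ₄` -/

section Pairing

variable (t : ℚˣ)

/-- The isomorphism `E'[φ̂] ≃ μ₄` by which the translations act on the fourth root `dualRoot` of
`(x² - y) ∘ φ̂`: translation by `T'` multiplies `dualRoot` by `w T'`. -/
lemma exists_weilHom : ∃ w : equivKer (dualHom t) →+[GQ] Mu4, Function.Bijective w ∧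
    (∀ (i : Qbar) (hi : i ^ 2 = -1), (w (dualKerGen t i hi)).val = i) ∧
    ∀ (T' : equivKer (dualHom t)) (P : PtE' t), dualFun t P ≠ 0 →
      dualRoot t (P + T') = (w T').val * dualRoot t P := by
  obtain ⟨i, hi⟩ := exists_sq_eq_neg_one
  obtain ⟨w, hw⟩ : ∃ w : equivKer (dualHom t) ≃+ Mu4,
      w (dualKerGen t i hi) = Mu4.of i (pow_four_eq_one_of_sq hi) :=
    ⟨addEquivOfAddOrderOfEq (fun T => by
        obtain ⟨m, hm⟩ := exists_eq_smul_dualKerGen t i hi T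
        exact ⟨m, hm.symm⟩)
      (fun ζ => by
        obtain ⟨m, hm⟩ := exists_eq_smul_Mu4 hi ζ
        exact ⟨m, hm.symm⟩)
      ((addOrderOf_dualKerGen t i hi).trans (addOrderOf_Mu4_of hi).symm),
      addEquivOfAddOrderOfEq_apply_gen _ _ _⟩
  have hval : ∀ (j : Qbar) (hj : j ^ 2 = -1), (w (dualKerGen t j hj)).val = j := by
    intro j hj
    have h : (j - i) * (j + i) = 0 := by linear_combination hj - hi
    rcases mul_eq_zero.mp h with h | h
    · obtain rfl : j = i := sub_eq_zero.mp h
      rw [hw, Mu4.val_of]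
    · obtain rfl : j = -i := eq_neg_of_add_eq_zero_left h
      have e : dualKerGen t (-i) hj = -dualKerGen t i hi :=
        Subtype.ext (dualTorsionPt_neg t i hi hj)
      have hi0 : i ≠ 0 := by rintro rfl; norm_num at hi
      rw [e, map_neg, Mu4.val_neg, hw, Mu4.val_of]
      field_simp
      linear_combination hi
  refine ⟨{ toFun := w
            map_smul' := fun σ T => ?_
            map_zero' := map_zero w
            map_add' := map_add w }, w.bijective, hval, ?_⟩
  · change w (σ • T) = σ • w T
    obtain ⟨m, rfl⟩ := exists_eq_smul_dualKerGen t i hi T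
    rw [smul_zsmul_comm, map_zsmul, map_zsmul, smul_zsmul_comm, smul_dualKerGen]
    congr 1
    apply Mu4.val_injective
    rw [hval, Mu4.val_smul, hval]
  · intro T' P hP
    change dualRoot t (P + T') = (w T').val * dualRoot t P
    obtain ⟨m, rfl⟩ := exists_eq_smul_dualKerGen t i hi T'
    have hi0 : i ≠ 0 := by rintro rfl; norm_num at hi
    rw [map_zsmul, Mu4.val_zsmul, hval]
    have hker : ∀ m : ℤ, dualFun t (P + m • dualTorsionPt t i hi) ≠ 0 := by
      intro m
      have h : dualFun t (P + m • dualTorsionPt t i hi) =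
          dualFun t P + dualFun t (m • dualTorsionPt t i hi) :=
        map_add (dualHom t) P _
      have h' : dualFun t (m • dualTorsionPt t i hi) = 0 := (m • dualKerGen t i hi).2
      rwa [h, h', add_zero]
    have hstep : ∀ m : ℤ, dualRoot t (P + (m + 1) • dualTorsionPt t i hi) =
        i * dualRoot t (P + m • dualTorsionPt t i hi) := by
      intro m
      rw [← dualRoot_add_dualTorsionPt t i hi _ (hker m), add_zsmul, one_zsmul, add_assoc]
    change dualRoot t (P + m • dualTorsionPt t i hi) = _
    induction m using Int.induction_on with
    | zero => rw [zero_zsmul, add_zero, zpow_zero, one_mul]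
    | succ k ih => rw [hstep, ih, zpow_add_one₀ hi0]; ring
    | pred k ih =>
      have h := hstep (-(k : ℤ) - 1)
      rw [sub_add_cancel, ih] at h
      apply mul_left_cancel₀ hi0
      rw [← h, ← mul_assoc, zpow_sub_one₀ hi0]
      field_simp

end Pairing

/-! ### The descent map -/

section Descent

variable (t : ℚˣ)

lemma GalH1.map_eq_zsmul {G M N : Type*} [Group G] [TopologicalSpace G] [AddCommGroup M]
    [DistribMulAction G M] [AddCommGroup N] [DistribMulAction G N] {f g : M →+[G] N} {m : ℤ}
    (h : ∀ x, g x = m • f x) (y : GalH1 G M) : GalH1.map g y = m • GalH1.map f y := by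
  obtain ⟨c, rfl⟩ := GalH1.mk_surjective y
  have e : ContCocycle.map g c = m • ContCocycle.map f c :=
    Subtype.ext (funext fun σ => h (c.1 σ))
  rw [GalH1.map_mk, GalH1.map_mk, e]
  rfl

lemma QModFourth.mk_surjective : Function.Surjective QModFourth.mk := fun x =>
  QuotientGroup.mk_surjective (Additive.toMul x)

lemma QModFourth.mk_zpow (d : ℚˣ) (m : ℤ) : QModFourth.mk (d ^ m) = m • QModFourth.mk d := rfl

lemma QModFourth.four_smul (x : QModFourth) : (4 : ℤ) • x = 0 := by
  obtain ⟨d, rfl⟩ := QModFourth.mk_surjective x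
  rw [← QModFourth.mk_zpow]
  exact (QuotientGroup.eq_one_iff _).mpr ⟨d, rfl⟩

/-- At the points where `x² - y` does not vanish, its value describes the connecting map: its fourth
root `β` is a value of the function `dualRoot`, and `σ β / β` measures the translation by
`σ P' - P'`. -/
lemma map_connectingMap_some {w : equivKer (dualHom t) →+[GQ] Mu4}
    (hw : ∀ (T' : equivKer (dualHom t)) (P : PtE' t), dualFun t P ≠ 0 →
      dualRoot t (P + T') = (w T').val * dualRoot t P)
    {κ : QModFourth →+ GalH1 GQ Mu4} (hκ : IsKummerMap κ)
    {δ : (PtEQ t ⧸ ratImage (dualHom t)) →+ GalH1 GQ (equivKer (dualHom t))}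
    (hδ : IsConnectingMap (dualHom t) δ) {x y : ℚ} (h : ((curveE t)⁄ℚ).Nonsingular x y) (d : ℚˣ)
    (hd : (d : ℚ) = x ^ 2 - y) :
    GalH1.map w (δ (QuotientAddGroup.mk (.some x y h))) = κ (QModFourth.mk d) := by
  obtain ⟨P', hP'⟩ := dualFun_surjective t (ratPoint (curveE t) (.some x y h))
  have hβ : dualRoot t P' ^ 4 = algebraMap ℚ Qbar d := by
    rw [dualRoot_pow_four t _ hP', hd, map_sub, map_pow]
    rfl
  obtain ⟨c, hc, hcδ⟩ := hδ _ P' hP'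
  obtain ⟨c', hc', hcκ⟩ := hκ d _ hβ
  rw [hcδ, hcκ, GalH1.map_mk]
  congr 1
  refine Subtype.ext (funext fun σ => Mu4.val_injective ?_)
  rw [hc', eq_div_iff (ne_zero_of_pow_eq_unit hβ)]
  have hne : dualFun t P' ≠ 0 := by rw [hP']; exact Point.some_ne_zero _
  refine (hw (c.1 σ) P' hne).symm.trans ?_
  rw [hc, add_sub_cancel, dualRoot_smul]

/-- The connecting map is given by the function `x² - y`; at its zero `(0, 0)` the value is
found from that at `-(0, 0)`. -/
lemma map_connectingMap {w : equivKer (dualHom t) →+[GQ] Mu4}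
    (hw : ∀ (T' : equivKer (dualHom t)) (P : PtE' t), dualFun t P ≠ 0 →
      dualRoot t (P + T') = (w T').val * dualRoot t P)
    {κ : QModFourth →+ GalH1 GQ Mu4} (hκ : IsKummerMap κ)
    {δ : (PtEQ t ⧸ ratImage (dualHom t)) →+ GalH1 GQ (equivKer (dualHom t))}
    (hδ : IsConnectingMap (dualHom t) δ) (P : PtEQ t) :
    GalH1.map w (δ (QuotientAddGroup.mk P)) = κ (QModFourth.mk (descentValue t P)) := by
  rcases P with _ | ⟨x, y, h⟩
  · have e1 : (QuotientAddGroup.mk .zero : PtEQ t ⧸ ratImage (dualHom t)) = 0 := rfl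
    have e2 : QModFourth.mk (descentValue t .zero) = 0 := rfl
    rw [e1, e2, map_zero, map_zero, map_zero]
  · by_cases h0 : x = 0 ∧ y = 0
    · have hv : descentValue t (.some x y h) = (Units.mk0 (coefE t) (coefE_ne t))⁻¹ := by
        rw [descentValue, dif_pos h0]
      have hm : QModFourth.mk (Units.mk0 (coefE t) (coefE_ne t))⁻¹ =
        -QModFourth.mk (Units.mk0 (coefE t) (coefE_ne t)) := rfl
      obtain ⟨rfl, rfl⟩ := h0
      obtain ⟨h', e⟩ : ∃ h', -(Point.some 0 0 h : PtEQ t) = .some 0 (-coefE t) h' := by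
        have e' : ((curveE t)⁄ℚ).negY 0 0 = -coefE t := by simp [negY, curveE, tateCurve]
        rw [← e']
        exact ⟨_, Point.neg_some _⟩
      have key := map_connectingMap_some t hw hκ hδ h' (Units.mk0 (coefE t) (coefE_ne t))
        (by simp)
      rw [← e] at key
      have hneg : (QuotientAddGroup.mk (-(Point.some 0 0 h : PtEQ t)) :
          PtEQ t ⧸ ratImage (dualHom t)) = -QuotientAddGroup.mk (Point.some 0 0 h : PtEQ t) := rfl
      rw [hneg, map_neg, map_neg, neg_eq_iff_eq_neg] at key
      rw [hv, hm, map_neg, key]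
    · refine map_connectingMap_some t hw hκ hδ h _ ?_
      rw [descentValue, dif_neg h0, Units.val_mk0]

end Descent

end

theorem mainTheorem5 (t : ℚˣ) :
    -- the explicit maps are Galois equivariant group homomorphisms, dual to each other
    ∃ (φ : PtE t →+[GQ] PtE' t) (φd : PtE' t →+[GQ] PtE t),
      (∀ P, φ P = phiFun t P) ∧ (∀ P', φd P' = dualFun t P') ∧
      (∀ P, φd (φ P) = 4 • P) ∧ (∀ P', φ (φd P') = 4 • P') ∧
      Function.Surjective φd ∧
    -- `E[φ]` is generated by `T₀ = (0, 0)`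
    ∃ T₀ : equivKer φ, (T₀ : PtE t) = originPt t ∧ (∀ T : equivKer φ, ∃ m : ℤ, T = m • T₀) ∧
    -- (1) the bilinear pairing `e_φ : E'[φ̂] × E[φ] → μ₄`
    ∃ e : equivKer φd →+ equivKer φ →+ Mu4,
      -- non-degenerate on both sides
      (∀ T' : equivKer φd, (∀ T : equivKer φ, e T' T = 0) → T' = 0) ∧
      (∀ T : equivKer φ, (∀ T' : equivKer φd, e T' T = 0) → T = 0) ∧
      -- Galois invariant
      (∀ (σ : GQ) (T' : equivKer φd) (T : equivKer φ), e (σ • T') (σ • T) = σ • e T' T) ∧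
      -- alternating: `e_φ(φ S, T) = e₄(S, T)` for an alternating pairing `e₄` on `E[4]`
      (∃ e₄ : equivKer (mulFour t) →+ equivKer (mulFour t) →+ Mu4,
        (∀ S, e₄ S S = 0) ∧
        (∀ S, (∀ R, e₄ S R = 0) → S = 0) ∧
        (∀ (σ : GQ) (S R : equivKer (mulFour t)), e₄ (σ • S) (σ • R) = σ • e₄ S R) ∧
        ∀ (S R : equivKer (mulFour t)) (T' : equivKer φd) (T : equivKer φ),
          (T' : PtE' t) = φ (S : PtE t) → (T : PtE t) = (R : PtE t) → e T' T = e₄ S R) ∧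
      -- the value at the generators
      (∀ (i : Qbar) (hi : i ^ 2 = -1), ∃ T' : equivKer φd,
        (T' : PtE' t) = dualTorsionPt t i hi ∧ (e T' T₀).val = i) ∧
    -- (2) the bilinear pairing `b : E(ℚ) / φ̂(E'(ℚ)) × E[φ] → ℚˣ / (ℚˣ)⁴`
    ∃ b : (PtEQ t ⧸ ratImage φd) →+ equivKer φ →+ QModFourth,
      (∀ (P : PtEQ t) (m : ℤ),
        b (QuotientAddGroup.mk P) (m • T₀) = QModFourth.mk (descentValue t P ^ m)) ∧
      (∀ p : PtEQ t ⧸ ratImage φd, (∀ T : equivKer φ, b p T = 0) → p = 0) ∧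
    -- (3) `e_φ(·, T)` is a map of Galois modules for every `T`, and for `T = T₀` it identifies
    -- `E'[φ̂]` with `μ₄`; the Kummer map is an isomorphism onto `H¹(G_ℚ, μ₄)`, and transported
    -- along this identification it is an isomorphism `ℚˣ / (ℚˣ)⁴ ≃ H¹(G_ℚ, E'[φ̂])`
    ∃ eHom : equivKer φ → (equivKer φd →+[GQ] Mu4),
      (∀ (T : equivKer φ) (T' : equivKer φd), eHom T T' = e T' T) ∧
      Function.Bijective (eHom T₀) ∧
    ∃ κ : QModFourth ≃+ GalH1 GQ Mu4, IsKummerMap (κ : QModFourth →+ GalH1 GQ Mu4) ∧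
    ∃ δQ : QModFourth ≃+ GalH1 GQ (equivKer φd), (∀ d, GalH1.map (eHom T₀) (δQ d) = κ d) ∧
    -- (4) the connecting homomorphism `δ_E`
    ∃ δE : (PtEQ t ⧸ ratImage φd) →+ GalH1 GQ (equivKer φd), IsConnectingMap φd δE ∧
      -- the relation in cohomology
      (∀ (p : PtEQ t ⧸ ratImage φd) (T : equivKer φ),
        GalH1.map (eHom T) (δE p) = κ (b p T)) ∧
      -- the relation for each representing cocycle and every `σ`
      (∀ (P : PtEQ t) (T : equivKer φ) (P' : PtE' t), φd P' = ratPoint (curveE t) P →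
        ∃ (d : ℚˣ) (β : Qbar), QModFourth.mk d = b (QuotientAddGroup.mk P) T ∧
          β ^ 4 = algebraMap ℚ Qbar d ∧
          ∀ (σ : GQ) (T' : equivKer φd), (T' : PtE' t) = σ • P' - P' →
            (e T' T).val = σ β / β) ∧
      -- `δ_E` is `P ↦ δ_ℚ(b(P, T₀))`
      (∀ p : PtEQ t ⧸ ratImage φd, δE p = δQ (b p T₀)) := by
  obtain ⟨w, hwb, hwv, hwt⟩ := exists_weilHom t
  have hT₀ := exists_eq_smul_kerGen t
  have h4 := addOrderOf_kerGen t
  obtain ⟨i, hi⟩ := exists_sq_eq_neg_one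
  have hμ4 : ∀ ζ : Mu4, (4 : ℤ) • ζ = 0 := fun ζ => (natCast_zsmul ζ 4).trans ζ.four_smul
  obtain ⟨e, he⟩ := exists_bilinear_of_cyclic hT₀ h4 (w : equivKer (dualHom t) →+ Mu4)
    fun T' => hμ4 _
  replace he : ∀ T' (m : ℤ), e T' (m • kerGen t) = m • w T' := he
  have he1 : ∀ T', e T' (kerGen t) = w T' := fun T' => by
    simpa only [one_zsmul] using he T' 1
  have hinv : ∀ (σ : GQ) T' T, e (σ • T') T = σ • e T' T := by
    intro σ T' T
    obtain ⟨m, rfl⟩ := hT₀ T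
    rw [he, he, map_smul, smul_zsmul_comm]
  -- the form on `E[4]`, an extension of `μ₄` by `E[φ]` through `w ∘ φ`
  have hmem : ∀ S : equivKer (mulFour t), dualHom t (phiHom t S.1) = 0 := fun S =>
    (dualFun_phiFun t S.1).trans S.2
  let ε : equivKer (mulFour t) →+[GQ] Mu4 :=
    { toFun := fun S => w ⟨phiHom t S.1, hmem S⟩
      map_smul' := fun σ S => by
        change w _ = σ • w _
        rw [← map_smul]
        congr 1
        exact Subtype.ext (map_smul (phiHom t) σ S.1)
      map_zero' := by
        refine Eq.trans (congrArg w ?_) (map_zero w)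
        exact Subtype.ext (map_zero (phiHom t))
      map_add' := fun S R => by
        rw [← map_add]
        congr 1
        exact Subtype.ext (map_add (phiHom t) S.1 R.1) }
  have hε : Function.Surjective ε := by
    intro ζ
    obtain ⟨T', rfl⟩ := hwb.2 ζ
    obtain ⟨S, hS⟩ := phiFun_surjective t T'.1
    have hS4 : mulFour t S = 0 := by
      refine (dualFun_phiFun t S).symm.trans ?_
      rw [hS]
      exact T'.2
    exact ⟨⟨S, hS4⟩, congrArg w (Subtype.ext hS)⟩
  let T₄ : equivKer (mulFour t) := ⟨originPt t, four_smul_originPt t⟩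
  have hT₄ : addOrderOf T₄ = 4 := by
    rw [← h4, ← AddSubgroup.addOrderOf_coe T₄, ← AddSubgroup.addOrderOf_coe (kerGen t)]
    rfl
  obtain ⟨e₄, he₄a, he₄n, he₄g, he₄⟩ := exists_alternating_of_extension ε hε
    (fun S => Subtype.ext S.2) (exists_eq_smul_Mu4 hi) (addOrderOf_Mu4_of hi) hT₄
    (fun σ => Subtype.ext (smul_originPt t σ))
    ((congrArg w (Subtype.ext (phiFun_originPt t))).trans (map_zero w))
    (fun S hS => by
      have h1 := hwb.1 (hS.trans (map_zero w).symm)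
      obtain ⟨m, hm⟩ := exists_eq_smul_originPt t S.1 (congrArg Subtype.val h1)
      exact ⟨m, Subtype.ext hm⟩)
  obtain ⟨κ, hκ⟩ := exists_kummerMap
  obtain ⟨δE, hδE, hδinj⟩ := exists_connectingMap (dualHom t) (dualFun_surjective t)
  have hH := GalH1.map_bijective w hwb
  -- the descent pairing is the transport of the connecting map
  obtain ⟨b, hb⟩ := exists_bilinear_of_cyclic hT₀ h4
    ((κ.symm : GalH1 GQ Mu4 →+ QModFourth).comp ((GalH1.map w).comp δE))
    fun p => QModFourth.four_smul _
  replace hb : ∀ p (m : ℤ), b p (m • kerGen t) = m • κ.symm (GalH1.map w (δE p)) := hb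
  have hb1 : ∀ p, κ (b p (kerGen t)) = GalH1.map w (δE p) := fun p => by
    have h := hb p 1
    rw [one_zsmul, one_zsmul] at h
    rw [h, AddEquiv.apply_symm_apply]
  let eHom : equivKer (phiHom t) → (equivKer (dualHom t) →+[GQ] Mu4) := fun T =>
    { toFun := fun T' => e T' T
      map_smul' := fun σ T' => hinv σ T' T
      map_zero' := by rw [map_zero]; rfl
      map_add' := fun S R => by rw [map_add]; rfl }
  have heHom : ∀ T T', eHom T T' = e T' T := fun T T' => rfl
  have heT₀ : eHom (kerGen t) = w := DistribMulActionHom.ext he1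
  let δQ : QModFourth ≃+ GalH1 GQ (equivKer (dualHom t)) :=
    κ.trans (AddEquiv.ofBijective (GalH1.map w) hH).symm
  have hδQ : ∀ d, GalH1.map w (δQ d) = κ d := fun d =>
    (AddEquiv.ofBijective (GalH1.map w) hH).apply_symm_apply (κ d)
  have hcoh : ∀ p T, GalH1.map (eHom T) (δE p) = κ (b p T) := by
    intro p T
    obtain ⟨m, rfl⟩ := hT₀ T
    rw [hb, map_zsmul, AddEquiv.apply_symm_apply]
    exact GalH1.map_eq_zsmul (fun T' => he T' m) _
  refine ⟨phiHom t, dualHom t, fun P => rfl, fun P' => rfl, dualFun_phiFun t, phiFun_dualFun t,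
    dualFun_surjective t, kerGen t, rfl, hT₀, e, fun T' h => ?_, fun T h => ?_, fun σ T' T => ?_,
    ⟨e₄, he₄a, he₄n, he₄g, fun S R T' T hS hR => ?_⟩,
    fun i hi => ⟨dualKerGen t i hi, rfl, by rw [he1, hwv]⟩, b, fun P m => ?_, fun p h => ?_,
    eHom, heHom, by rw [heT₀]; exact hwb, κ, hκ, δQ, fun d => by rw [heT₀, hδQ], δE, hδE, hcoh,
    fun P T P' hP' => ?_, fun p => hH.1 (by rw [hδQ, hb1])⟩
  · exact hwb.1 (((he1 T').symm.trans (h (kerGen t))).trans (map_zero w).symm)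
  · obtain ⟨m, rfl⟩ := hT₀ T
    have h1 := h (dualKerGen t i hi)
    rw [he, ← map_zsmul, ← map_zero w] at h1
    have h2 := hwb.1 h1
    rw [← addOrderOf_dvd_iff_zsmul_eq_zero, addOrderOf_dualKerGen, ← h4,
      addOrderOf_dvd_iff_zsmul_eq_zero] at h2
    exact h2
  · rw [smul_ker, hinv]
  · obtain ⟨m, rfl⟩ := hT₀ T
    have hR' : R = m • T₄ := Subtype.ext hR.symm
    rw [he, hR', he₄]
    exact congrArg (fun x => m • w x) (Subtype.ext hS)
  · rw [hb, map_connectingMap t hwt hκ hδE, QModFourth.mk_zpow]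
    congr 1
    exact κ.symm_apply_apply _
  · have h1 := hb1 p
    rw [h, map_zero] at h1
    exact hδinj (hH.1 (by rw [← h1, map_zero, map_zero]))
  · obtain ⟨c, hc, hcδ⟩ := hδE P P' hP'
    obtain ⟨d, hd⟩ := QModFourth.mk_surjective (b (QuotientAddGroup.mk P) T)
    obtain ⟨β, hβ⟩ := IsAlgClosed.exists_pow_nat_eq (algebraMap ℚ Qbar d) (n := 4) (by norm_num)
    obtain ⟨c', hc', hcκ⟩ := hκ d β hβ
    have h1 := hcoh (QuotientAddGroup.mk P) T
    rw [hcδ, ← hd, GalH1.map_mk] at h1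
    obtain ⟨ζ, hζ⟩ := (GalH1.mk_eq_mk_iff _ _).mp (h1.trans hcκ)
    -- the cocycles differ by the coboundary of `ζ`, which changes the fourth root by the factor `ζ`
    refine ⟨d, β * ζ.val, hd, by rw [mul_pow, ζ.val_pow_four, mul_one, hβ], fun σ T' hT' => ?_⟩
    obtain rfl : T' = c.1 σ := Subtype.ext (hT'.trans (hc σ).symm)
    have h2 : e (c.1 σ) T - c'.1 σ = σ • ζ - ζ := hζ σ
    rw [eq_add_of_sub_eq h2, Mu4.val_add, Mu4.val_sub, Mu4.val_smul, hc', map_mul,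
      mul_div_mul_comm, mul_comm]
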